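/- Let $R$ be an ordered ring (a commutative unital ring with $1\neq 0$ and a total order compatible with addition and with products of positive elements), let $C=R(i)$ with $i^2=-1$, with conjugation $\overline{x+iy}=x-iy$; for $z\in C$ write $z\ge 0$ if $z\in R$ and $z\ge 0$ in $R$. A unital $^*$-algebra is an associative unital $C$-algebra with a conjugate-linear involutive anti-automorphism $^*$. A linear functional $\omega$ on a $^*$-algebra $D$ is positive if $\omega(a^*a)\ge 0$ for all $a\in D$, and $a\in D$ is positive ($a\in D^+$) if $\omega(a)\ge 0$ for all positive linear functionals $\omega$. The matrix algebra $M_n(D)$ has the involution $(a_{ij})^*=(a_{ji}^*)$. A projection is an element $P=P^2=P^*$. Bimodules carry a compatible $C$-module structure and units act as the identity. $\mathrm{Pic}(B,A)$ is the set of isomorphism classes of invertible $(B,A)$-bimodules, i.e. of $(B,A)$-bimodules $E$ for which there is an $(A,B)$-bimodule $E'$ with $E'\otimes_B E\cong A$ and $E\otimes_A E'\cong B$ as bimodules. A $(B,A)$-pre-Hilbert bimodule is a $(B,A)$-bimodule $E$ with an $A$-valued sesquilinear inner product $\langle\cdot,\cdot\rangle$, linear in the second argument, such that $\langle x,y\rangle=\langle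 y,x\rangle^*$, $\langle x,ya\rangle=\langle x,y\rangle a$ and $\langle bx,y\rangle=\langle x,b^*y\rangle$, which is non-degenerate ($\langle x,y\rangle=0$ for all $y$ implies $x=0$) and completely positive ($(\langle x_i,x_j\rangle)_{ij}\in M_n(A)^+$ for all $n$ and $x_1,\dots,x_n\in E$). The internal tensor product of a $(D,B)$- and a $(B,A)$-pre-Hilbert bimodule $F$, $E$ is the quotient of $F\otimes_B E$, with inner product $\langle y_1\otimes x_1,y_2\otimes x_2\rangle=\langle x_1,\langle y_1,y_2\rangle x_2\rangle$, by its degeneracy space. $\mathrm{StrPic}(B,A)$ is the set of classes, under isomorphism of bimodules preserving inner products, of those $(B,A)$-pre-Hilbert bimodules that are invertible for the internal tensor product, the units being the algebras themselves with $\langle a,b\rangle=a^*b$. The map $\mathrm{StrPic}(B,A)\to\mathrm{Pic}(B,A)$ forgets the inner product. Let $A$ and $B$ be unital $^*$-algebras which are Morita equivalent as algebras, i.e. $\mathrm{Pic}(B,A)\neq\emptyset$. Assume: (I) for all $n$ and $M\in M_n(A)$, the matrix $1+M^*M$ is invertible; (II$^-$) for all $n$, all invertible $H\in M_n(A)^+$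 and all projections $P\in M_n(A)$ with $PH=HP$ there is an invertible $U\in M_n(A)$ with $H=U^*U$ and $PU=UP$; (III) for all $n$ and all projections $P\in M_n(A)$: if $B$ and $PM_n(A)P$ are isomorphic as unital $C$-algebras, then they are $^*$-isomorphic. Then the map $\mathrm{StrPic}(B,A)\to\mathrm{Pic}(B,A)$ is surjective if and only if $B$ satisfies (IV) for every $C$-algebra automorphism $\Phi$ of $B$ there is an invertible $U\in B$ with $\Phi^*\circ\Phi^{-1}=\mathrm{Ad}(U^*U)$, where $\Phi^*(b)=\Phi(b^*)^*$ and $\mathrm{Ad}(V)b=VbV^{-1}$. -/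

import Mathlib

universe w u

namespace StrongMorita

open scoped TensorProduct

/-! ## The ground ring and positivity -/

/-- The ring `R(i)` with `i ^ 2 = -1`; its `star` is the conjugation `x + i y ↦ x - i y`. -/
abbrev Cx (R : Type w) [CommRing R] : Type w := QuadraticAlgebra R (-1) 0

section Positivity

variable (R : Type w) [CommRing R] [LinearOrder R] [IsStrictOrderedRing R]

/-- `z ≥ 0` in `R(i)`: `z` lies in `R` and is nonnegative there. -/
def IsNonneg {R : Type w} [CommRing R] [LinearOrder R] (z : Cx R) : Prop :=
  z.im = 0 ∧ 0 ≤ z.re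

/-- A linear functional `ω` with `ω (a* a) ≥ 0` for all `a`. -/
def IsPositiveFunctional {A : Type u} [Ring A] [StarRing A] [Algebra (Cx R) A]
    (ω : A →ₗ[Cx R] Cx R) : Prop :=
  ∀ a : A, IsNonneg (ω (star a * a))

/-- An element on which every positive linear functional is nonnegative. -/
def IsPositive {A : Type u} [Ring A] [StarRing A] [Algebra (Cx R) A] (a : A) : Prop :=
  ∀ ω : A →ₗ[Cx R] Cx R, IsPositiveFunctional R ω → IsNonneg (ω a)

end Positivity

/-! ## Bimodules and the ring-theoretic Picard groupoid -/

section Bimodules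

/-- A `(B, A)`-bimodule over the commutative ring `S`: `B` acts on the left, `A` on the right
(as a module over `Aᵐᵒᵖ`), the actions commute, units act as the identity, and both actions are
compatible with the `S`-module structure. -/
structure Bimod (S : Type w) (B A : Type u) [CommRing S] [Ring B] [Algebra S B]
    [Ring A] [Algebra S A] where
  carrier : Type u
  [addCommGroup : AddCommGroup carrier]
  [module : Module S carrier]
  [leftModule : Module B carrier]
  [rightModule : Module Aᵐᵒᵖ carrier]
  [leftTower : IsScalarTower S B carrier]
  [rightTower : IsScalarTower S Aᵐᵒᵖ carrier]
  [actionsCommute : SMulCommClass B Aᵐᵒᵖ carrier]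

attribute [instance] Bimod.addCommGroup Bimod.module Bimod.leftModule Bimod.rightModule
  Bimod.leftTower Bimod.rightTower Bimod.actionsCommute

variable {S : Type w} [CommRing S]
  {A B C : Type u} [Ring A] [Algebra S A] [Ring B] [Algebra S B] [Ring C] [Algebra S C]

instance : CoeSort (Bimod S B A) (Type u) := ⟨Bimod.carrier⟩

open scoped RightActions

/-- The algebra `A` as a bimodule over itself, by multiplication. -/
def Bimod.regular (S : Type w) (A : Type u) [CommRing S] [Ring A] [Algebra S A] :
    Bimod S A A where
  carrier := A

/-- Isomorphism of bimodules. -/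
def Bimod.Iso (E F : Bimod S B A) : Prop :=
  ∃ φ : E ≃ₗ[S] F, (∀ (b : B) (x : E), φ (b • x) = b • φ x) ∧
    ∀ (x : E) (a : A), φ (x <• a) = φ x <• a

/-- The relations `y b ⊗ x = y ⊗ b x`; the tensor product of `F` and `E` over `B` is the quotient
of `F ⊗[S] E` by them. -/
def balancing (F : Bimod S C B) (E : Bimod S B A) : Submodule S (F ⊗[S] E) :=
  Submodule.span S {t | ∃ (y : F) (b : B) (x : E), t = (y <• b) ⊗ₜ[S] x - y ⊗ₜ[S] (b • x)}

/-- The tensor product of bimodules over the middle algebra. -/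
abbrev BalancedTensor (F : Bimod S C B) (E : Bimod S B A) : Type u :=
  (F ⊗[S] E) ⧸ balancing F E

/-- `F ⊗_B E ≅ G` as `(C, A)`-bimodules. The actions on `F ⊗_B E` are determined by
`c (y ⊗ x) = (c y) ⊗ x` and `(y ⊗ x) a = y ⊗ (x a)`. -/
def TensorIso (F : Bimod S C B) (E : Bimod S B A) (G : Bimod S C A) : Prop :=
  ∃ φ : BalancedTensor F E ≃ₗ[S] G,
    (∀ (c : C) (y : F) (x : E), φ ((balancing F E).mkQ ((c • y) ⊗ₜ[S] x)) =
      c • φ ((balancing F E).mkQ (y ⊗ₜ[S] x))) ∧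
    ∀ (y : F) (x : E) (a : A), φ ((balancing F E).mkQ (y ⊗ₜ[S] (x <• a))) =
      φ ((balancing F E).mkQ (y ⊗ₜ[S] x)) <• a

/-- Invertibility of (the class of) a bimodule under the tensor product. -/
def Bimod.IsInvertible (E : Bimod S B A) : Prop :=
  ∃ F : Bimod S A B, TensorIso F E (Bimod.regular S A) ∧ TensorIso E F (Bimod.regular S B)

/-- The setoid of isomorphism on the invertible (that is, equivalence) bimodules. -/
def picSetoid (S : Type w) (B A : Type u) [CommRing S] [Ring B] [Algebra S B]
    [Ring A] [Algebra S A] : Setoid {E : Bimod S B A // E.IsInvertible} where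
  r E F := Bimod.Iso E.1 F.1
  iseqv :=
    { refl := fun E => ⟨LinearEquiv.refl S _, fun _ _ => rfl, fun _ _ => rfl⟩
      symm := by
        rintro E F ⟨φ, h1, h2⟩
        refine ⟨φ.symm, fun b x => ?_, fun x a => ?_⟩
        · apply φ.injective
          simp [h1]
        · apply φ.injective
          simp [h2]
      trans := by
        rintro E F G ⟨φ, h1, h2⟩ ⟨ψ, k1, k2⟩
        exact ⟨φ.trans ψ, fun b x => by simp [h1, k1], fun x a => by simp [h2, k2]⟩ }

/-- The arrows `Pic(B, A)` of the Picard groupoid: isomorphism classes of invertible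
`(B, A)`-bimodules. -/
def Pic (S : Type w) (B A : Type u) [CommRing S] [Ring B] [Algebra S B]
    [Ring A] [Algebra S A] : Type (max w (u + 1)) :=
  Quotient (picSetoid S B A)

end Bimodules

/-! ## Pre-Hilbert bimodules and the strong Picard groupoid -/

section PreHilbert

open scoped RightActions

/-- A `(B, A)`-pre-Hilbert bimodule: a bimodule with an `A`-valued inner product (linear in the
second argument) which is compatible with the left action, non-degenerate and completely
positive. -/
structure PreHilbertBimod (R : Type w) (B A : Type u)
    [CommRing R] [LinearOrder R] [IsStrictOrderedRing R]
    [Ring B] [StarRing B] [Algebra (Cx R) B]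
    [Ring A] [StarRing A] [Algebra (Cx R) A] extends Bimod (Cx R) B A where
  inner : carrier → carrier → A
  inner_add : ∀ x y z, inner x (y + z) = inner x y + inner x z
  inner_smul : ∀ (c : Cx R) x y, inner x (c • y) = c • inner x y
  star_inner : ∀ x y, star (inner y x) = inner x y
  inner_right_action : ∀ x y (a : A), inner x (y <• a) = inner x y * a
  compatible : ∀ (b : B) x y, inner (b • x) y = inner x (star b • y)
  nondegenerate : ∀ x, (∀ y, inner x y = 0) → x = 0
  completelyPositive : ∀ (n : ℕ) (x : Fin n → carrier),
    IsPositive R (Matrix.of fun i j => inner (x i) (x j))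

variable {R : Type w} [CommRing R] [LinearOrder R] [IsStrictOrderedRing R]
  {A B C : Type u}
  [Ring A] [StarRing A] [Algebra (Cx R) A]
  [Ring B] [StarRing B] [Algebra (Cx R) B]
  [Ring C] [StarRing C] [Algebra (Cx R) C]

instance : CoeSort (PreHilbertBimod R B A) (Type u) := ⟨fun E => E.carrier⟩

/-- Isomorphism of pre-Hilbert bimodules: a bimodule isomorphism preserving inner products. -/
def PreHilbertBimod.Iso (E F : PreHilbertBimod R B A) : Prop :=
  ∃ φ : E ≃ₗ[Cx R] F, (∀ (b : B) (x : E), φ (b • x) = b • φ x) ∧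
    (∀ (x : E) (a : A), φ (x <• a) = φ x <• a) ∧
    ∀ x y : E, F.inner (φ x) (φ y) = E.inner x y

/-- For `y : F`, `x : E`, the linear map `y' ⊗ x' ↦ ⟨y ⊗ x, y' ⊗ x'⟩ = ⟨x, ⟨y, y'⟩ x'⟩`. -/
def tensorInner (F : PreHilbertBimod R C B) (E : PreHilbertBimod R B A) (y : F) (x : E) :
    F ⊗[Cx R] E →ₗ[Cx R] A :=
  TensorProduct.lift <| LinearMap.mk₂ (Cx R) (fun (y' : F) (x' : E) => E.inner x (F.inner y y' • x'))
    (fun y₁ y₂ x' => by rw [F.inner_add, add_smul, E.inner_add])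
    (fun c y' x' => by rw [F.inner_smul, smul_assoc, E.inner_smul])
    (fun y' x₁ x₂ => by rw [smul_add, E.inner_add])
    (fun c y' x' => by
      rw [← algebraMap_smul B c x', smul_smul, ← Algebra.commutes, ← smul_smul, algebraMap_smul,
        E.inner_smul])

/-- The degeneracy space of the inner product on the tensor product. It contains the relations
`y b ⊗ x = y ⊗ b x` (see `balancing_le_degeneracy`), so that the quotient of `F ⊗[Cx R] E` by it is
the quotient of the tensor product of `F` and `E` over `B` by its degeneracy space. -/
def degeneracy (F : PreHilbertBimod R C B) (E : PreHilbertBimod R B A) :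
    Submodule (Cx R) (F ⊗[Cx R] E) :=
  ⨅ (y : F) (x : E), LinearMap.ker (tensorInner F E y x)

theorem balancing_le_degeneracy (F : PreHilbertBimod R C B) (E : PreHilbertBimod R B A) :
    balancing F.toBimod E.toBimod ≤ degeneracy F E := by
  refine Submodule.span_le.2 ?_
  rintro _ ⟨y, b, x, rfl⟩
  simp only [degeneracy, SetLike.mem_coe, Submodule.mem_iInf, LinearMap.mem_ker]
  intro y' x'
  simp [tensorInner, F.inner_right_action, mul_smul]

/-- The internal tensor product of pre-Hilbert bimodules (as a module over the ground ring). -/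
abbrev InternalTensor (F : PreHilbertBimod R C B) (E : PreHilbertBimod R B A) : Type u :=
  (F ⊗[Cx R] E) ⧸ degeneracy F E

/-- `F ⊗̂_B E ≅ G` as pre-Hilbert `(C, A)`-bimodules, where `F ⊗̂_B E` is the internal tensor
product. Actions and inner product on the latter are determined by `c (y ⊗ x) = (c y) ⊗ x`,
`(y ⊗ x) a = y ⊗ (x a)` and `⟨y₁ ⊗ x₁, y₂ ⊗ x₂⟩ = ⟨x₁, ⟨y₁, y₂⟩ x₂⟩`. -/
def InternalTensorIso (F : PreHilbertBimod R C B) (E : PreHilbertBimod R B A)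
    (G : PreHilbertBimod R C A) : Prop :=
  ∃ φ : InternalTensor F E ≃ₗ[Cx R] G,
    (∀ (c : C) (y : F) (x : E), φ ((degeneracy F E).mkQ ((c • y) ⊗ₜ[Cx R] x)) =
      c • φ ((degeneracy F E).mkQ (y ⊗ₜ[Cx R] x))) ∧
    (∀ (y : F) (x : E) (a : A), φ ((degeneracy F E).mkQ (y ⊗ₜ[Cx R] (x <• a))) =
      φ ((degeneracy F E).mkQ (y ⊗ₜ[Cx R] x)) <• a) ∧
    ∀ (y₁ y₂ : F) (x₁ x₂ : E),
      G.inner (φ ((degeneracy F E).mkQ (y₁ ⊗ₜ[Cx R] x₁)))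
          (φ ((degeneracy F E).mkQ (y₂ ⊗ₜ[Cx R] x₂))) =
        E.inner x₁ (F.inner y₁ y₂ • x₂)

/-- The algebra `A` as a pre-Hilbert bimodule over itself, with `⟨a, b⟩ = a* b`. -/
def PreHilbertBimod.regular (R : Type w) (A : Type u)
    [CommRing R] [LinearOrder R] [IsStrictOrderedRing R]
    [Ring A] [StarRing A] [Algebra (Cx R) A] : PreHilbertBimod R A A where
  toBimod := Bimod.regular (Cx R) A
  inner (a b : A) := star a * b
  inner_add (a b c : A) := mul_add (star a) b c
  inner_smul c (a b : A) := mul_smul_comm c (star a) b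
  star_inner (a b : A) := by simp
  inner_right_action (a b c : A) := (mul_assoc (star a) b c).symm
  compatible (b x y : A) := by
    change star (b * x) * y = star x * (star b * y)
    rw [star_mul, mul_assoc]
  nondegenerate (x : A) h := by
    have h1 := h (1 : A)
    change star x * 1 = 0 at h1
    rwa [mul_one, star_eq_zero] at h1
  completelyPositive n (x : Fin n → A) := by
    intro ω hω
    cases n with
    | zero =>
      have h : (Matrix.of fun i j => star (x i) * x j) =
          star (0 : Matrix (Fin 0) (Fin 0) A) * 0 := Subsingleton.elim _ _
      exact h ▸ hω 0
    | succ n =>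
      have h : (Matrix.of fun i j => star (x i) * x j) =
          star (Matrix.of fun (i : Fin (n + 1)) (j : Fin (n + 1)) => if i = 0 then x j else 0) *
            (Matrix.of fun (i : Fin (n + 1)) (j : Fin (n + 1)) => if i = 0 then x j else 0) := by
        ext i j
        rw [Matrix.mul_apply, Finset.sum_eq_single 0]
        · simp [Matrix.star_apply]
        · intro k _ hk
          simp [hk]
        · simp
      exact h ▸ hω _

/-- Invertibility of (the class of) a pre-Hilbert bimodule under the internal tensor product. -/
def PreHilbertBimod.IsInvertible (E : PreHilbertBimod R B A) : Prop :=
  ∃ F : PreHilbertBimod R A B, InternalTensorIso F E (PreHilbertBimod.regular R A) ∧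
    InternalTensorIso E F (PreHilbertBimod.regular R B)

/-- The setoid of isometric isomorphism on the invertible pre-Hilbert bimodules. -/
def strPicSetoid (R : Type w) (B A : Type u)
    [CommRing R] [LinearOrder R] [IsStrictOrderedRing R]
    [Ring B] [StarRing B] [Algebra (Cx R) B] [Ring A] [StarRing A] [Algebra (Cx R) A] :
    Setoid {E : PreHilbertBimod R B A // E.IsInvertible} where
  r E F := PreHilbertBimod.Iso E.1 F.1
  iseqv :=
    { refl := fun E => ⟨LinearEquiv.refl _ _, fun _ _ => rfl, fun _ _ => rfl, fun _ _ => rfl⟩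
      symm := by
        rintro E F ⟨φ, h1, h2, h3⟩
        refine ⟨φ.symm, fun b x => ?_, fun x a => ?_, fun x y => ?_⟩
        · apply φ.injective
          simp [h1]
        · apply φ.injective
          simp [h2]
        · simp [← h3]
      trans := by
        rintro E F G ⟨φ, h1, h2, h3⟩ ⟨ψ, k1, k2, k3⟩
        exact ⟨φ.trans ψ, fun b x => by simp [h1, k1], fun x a => by simp [h2, k2],
          fun x y => by simp [h3, k3]⟩ }

/-- The arrows `StrPic(B, A)` of the strong Picard groupoid: isometric isomorphism classes of
invertible `(B, A)`-pre-Hilbert bimodules. -/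
def StrPic (R : Type w) (B A : Type u)
    [CommRing R] [LinearOrder R] [IsStrictOrderedRing R]
    [Ring B] [StarRing B] [Algebra (Cx R) B] [Ring A] [StarRing A] [Algebra (Cx R) A] :
    Type (max w (u + 1)) :=
  Quotient (strPicSetoid R B A)

/-! ### Forgetting inner products preserves invertibility -/

/-- An isometric bimodule surjection from the tensor product onto the regular bimodule, before
passing to the quotient. -/
structure IsRegularPairing (F : PreHilbertBimod R A B) (E : PreHilbertBimod R B A)
    (α : F ⊗[Cx R] E →ₗ[Cx R] A) : Prop where
  surj : Function.Surjective α
  left : ∀ (c : A) (y : F) (x : E), α ((c • y) ⊗ₜ[Cx R] x) = c * α (y ⊗ₜ[Cx R] x)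
  right : ∀ (y : F) (x : E) (a : A), α (y ⊗ₜ[Cx R] (x <• a)) = α (y ⊗ₜ[Cx R] x) * a
  inner : ∀ (y₁ y₂ : F) (x₁ x₂ : E), star (α (y₁ ⊗ₜ[Cx R] x₁)) * α (y₂ ⊗ₜ[Cx R] x₂) =
    E.inner x₁ (F.inner y₁ y₂ • x₂)
  balanced : ∀ t ∈ balancing F.toBimod E.toBimod, α t = 0

theorem InternalTensorIso.exists_pairing {F : PreHilbertBimod R A B} {E : PreHilbertBimod R B A}
    (h : InternalTensorIso F E (PreHilbertBimod.regular R A)) :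
    ∃ α : F ⊗[Cx R] E →ₗ[Cx R] A, IsRegularPairing F E α := by
  obtain ⟨φ, h1, h2, h3⟩ := h
  refine ⟨φ.toLinearMap ∘ₗ (degeneracy F E).mkQ, ?_, h1, h2, h3, ?_⟩
  · exact φ.surjective.comp (Submodule.mkQ_surjective _)
  · intro t ht
    have : (degeneracy F E).mkQ t = 0 := by
      simpa using balancing_le_degeneracy F E ht
    exact (congrArg φ this).trans (map_zero φ)

/-- `x ⊗ t ↦ x · α t`. -/
def rightMap {F : PreHilbertBimod R A B} {E : PreHilbertBimod R B A}
    (α : F ⊗[Cx R] E →ₗ[Cx R] A) : E ⊗[Cx R] (F ⊗[Cx R] E) →ₗ[Cx R] E :=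
  TensorProduct.lift <| LinearMap.mk₂ (Cx R) (fun (x : E) (t : F ⊗[Cx R] E) => x <• α t)
    (fun x y t => smul_add _ _ _)
    (fun c x t => smul_comm _ _ _)
    (fun x s t => by rw [map_add, MulOpposite.op_add, add_smul])
    (fun c x t => by rw [map_smul, MulOpposite.op_smul, smul_assoc])

/-- `x ⊗ (w ⊗ z) ↦ β (x ⊗ w) · z`. -/
def leftMap {F : PreHilbertBimod R A B} {E : PreHilbertBimod R B A}
    (β : E ⊗[Cx R] F →ₗ[Cx R] B) : E ⊗[Cx R] (F ⊗[Cx R] E) →ₗ[Cx R] E :=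
  (TensorProduct.lift <| LinearMap.mk₂ (Cx R) (fun (t : E ⊗[Cx R] F) (z : E) => β t • z)
    (fun s t z => by rw [map_add, add_smul])
    (fun c t z => by rw [map_smul, smul_assoc])
    (fun t x y => smul_add _ _ _)
    (fun c t x => smul_comm _ _ _)) ∘ₗ
    (TensorProduct.assoc (Cx R) E F E).symm.toLinearMap

theorem PreHilbertBimod.inner_zero (E : PreHilbertBimod R B A) (x : E) : E.inner x 0 = 0 := by
  have := E.inner_add x 0 0
  simpa using this

theorem PreHilbertBimod.inner_add_left (E : PreHilbertBimod R B A) (x y z : E) :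
    E.inner (x + y) z = E.inner x z + E.inner y z := by
  rw [← E.star_inner, E.inner_add, star_add, E.star_inner, E.star_inner]

theorem PreHilbertBimod.inner_zero_left (E : PreHilbertBimod R B A) (x : E) :
    E.inner 0 x = 0 := by
  rw [← E.star_inner, E.inner_zero, star_zero]

theorem PreHilbertBimod.eq_zero_of_inner (E : PreHilbertBimod R B A) (x : E)
    (h : ∀ y, E.inner y x = 0) : x = 0 :=
  E.nondegenerate x fun y => by rw [← E.star_inner, h, star_zero]

theorem gram_eq {F : PreHilbertBimod R A B} {E : PreHilbertBimod R B A}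
    {α : F ⊗[Cx R] E →ₗ[Cx R] A} {β : E ⊗[Cx R] F →ₗ[Cx R] B}
    (hα : IsRegularPairing F E α) (hβ : IsRegularPairing E F β)
    (s t : E ⊗[Cx R] (F ⊗[Cx R] E)) :
    E.inner (leftMap β s) (leftMap β t) = E.inner (rightMap α s) (rightMap α t) := by
  induction s using TensorProduct.induction_on with
  | zero => simp only [map_zero, E.inner_zero_left]
  | add s₁ s₂ h₁ h₂ => simp only [map_add, E.inner_add_left, h₁, h₂]
  | tmul x s =>
    induction s using TensorProduct.induction_on with
    | zero => simp only [TensorProduct.tmul_zero, map_zero, E.inner_zero_left]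
    | add s₁ s₂ h₁ h₂ => simp only [TensorProduct.tmul_add, map_add, E.inner_add_left, h₁, h₂]
    | tmul w z =>
      induction t using TensorProduct.induction_on with
      | zero => simp only [map_zero, E.inner_zero]
      | add s₁ s₂ h₁ h₂ => simp only [map_add, E.inner_add, h₁, h₂]
      | tmul x' s =>
        induction s using TensorProduct.induction_on with
        | zero => simp only [TensorProduct.tmul_zero, map_zero, E.inner_zero]
        | add s₁ s₂ h₁ h₂ => simp only [TensorProduct.tmul_add, map_add, E.inner_add, h₁, h₂]
        | tmul w' z' =>
          have e1 : E.inner (x <• α (w ⊗ₜ[Cx R] z)) (x' <• α (w' ⊗ₜ[Cx R] z')) =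
              star (α (w ⊗ₜ[Cx R] z)) * (E.inner x x' * α (w' ⊗ₜ[Cx R] z')) := by
            rw [E.inner_right_action, ← E.star_inner, E.inner_right_action, star_mul,
              E.star_inner, mul_assoc]
          change E.inner (β (x ⊗ₜ[Cx R] w) • z) (β (x' ⊗ₜ[Cx R] w') • z') =
            E.inner (x <• α (w ⊗ₜ[Cx R] z)) (x' <• α (w' ⊗ₜ[Cx R] z'))
          rw [e1, ← hα.left, hα.inner, E.compatible, smul_smul, hβ.inner]

theorem rightMap_surjective {F : PreHilbertBimod R A B} {E : PreHilbertBimod R B A}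
    {α : F ⊗[Cx R] E →ₗ[Cx R] A} (hα : IsRegularPairing F E α) :
    Function.Surjective (rightMap α) := by
  intro x
  obtain ⟨c, hc⟩ := hα.surj 1
  refine ⟨x ⊗ₜ c, ?_⟩
  change x <• α c = x
  rw [hc, MulOpposite.op_one, one_smul]

theorem leftMap_assoc {F : PreHilbertBimod R A B} {E : PreHilbertBimod R B A}
    (β : E ⊗[Cx R] F →ₗ[Cx R] B) (c : E ⊗[Cx R] F) (z : E) :
    leftMap β (TensorProduct.assoc (Cx R) E F E (c ⊗ₜ z)) = β c • z := by
  simp [leftMap]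

theorem leftMap_surjective {F : PreHilbertBimod R A B} {E : PreHilbertBimod R B A}
    {β : E ⊗[Cx R] F →ₗ[Cx R] B} (hβ : IsRegularPairing E F β) :
    Function.Surjective (leftMap β) := by
  intro x
  obtain ⟨c, hc⟩ := hβ.surj 1
  exact ⟨_, (leftMap_assoc β c x).trans (by rw [hc, one_smul])⟩

theorem leftMap_eq_zero_iff {F : PreHilbertBimod R A B} {E : PreHilbertBimod R B A}
    {α : F ⊗[Cx R] E →ₗ[Cx R] A} {β : E ⊗[Cx R] F →ₗ[Cx R] B}
    (hα : IsRegularPairing F E α) (hβ : IsRegularPairing E F β)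
    (t : E ⊗[Cx R] (F ⊗[Cx R] E)) : leftMap β t = 0 ↔ rightMap α t = 0 := by
  constructor
  · intro h
    refine E.eq_zero_of_inner _ fun y => ?_
    obtain ⟨s, rfl⟩ := rightMap_surjective hα y
    rw [← gram_eq hα hβ, h, E.inner_zero]
  · intro h
    refine E.eq_zero_of_inner _ fun y => ?_
    obtain ⟨s, rfl⟩ := leftMap_surjective hβ y
    rw [gram_eq hα hβ, h, E.inner_zero]

theorem IsRegularPairing.ker_le {F : PreHilbertBimod R A B} {E : PreHilbertBimod R B A}
    {α : F ⊗[Cx R] E →ₗ[Cx R] A} {β : E ⊗[Cx R] F →ₗ[Cx R] B}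
    (hα : IsRegularPairing F E α) (hβ : IsRegularPairing E F β)
    (t : F ⊗[Cx R] E) (ht : α t = 0) : t ∈ balancing F.toBimod E.toBimod := by
  have hp : ∀ x : E, leftMap β (x ⊗ₜ[Cx R] t) = 0 := fun x => by
    rw [leftMap_eq_zero_iff hα hβ]
    change x <• α t = 0
    rw [ht, MulOpposite.op_zero, zero_smul]
  -- the maps `w ↦ ∑ uₖ β (xₖ ⊗ w)` for `c = ∑ uₖ ⊗ xₖ`
  let σ : F ⊗[Cx R] E →ₗ[Cx R] F →ₗ[Cx R] F :=
    TensorProduct.curry (rightMap β ∘ₗ (TensorProduct.assoc (Cx R) F E F).toLinearMap)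
  have hσ : ∀ (u : F) (x : E) (w : F), σ (u ⊗ₜ x) w = u <• β (x ⊗ₜ w) := fun u x w => rfl
  have hσ' : ∀ c w, σ c w = rightMap β (TensorProduct.assoc (Cx R) F E F (c ⊗ₜ w)) :=
    fun c w => rfl
  have hσr : ∀ (c : F ⊗[Cx R] E) (w : F) (b : B), σ c (w <• b) = σ c w <• b := by
    intro c w b
    induction c using TensorProduct.induction_on with
    | zero => simp
    | add c₁ c₂ h₁ h₂ => simp only [map_add, LinearMap.add_apply, h₁, h₂, smul_add]
    | tmul u x => rw [hσ, hσ, hβ.right, MulOpposite.op_mul, mul_smul]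
  have key : ∀ (u : F) (x : E) (s : F ⊗[Cx R] E),
      TensorProduct.map (σ (u ⊗ₜ x)) LinearMap.id s - u ⊗ₜ[Cx R] leftMap β (x ⊗ₜ[Cx R] s) ∈
        balancing F.toBimod E.toBimod := by
    intro u x s
    induction s using TensorProduct.induction_on with
    | zero => simp
    | add s₁ s₂ h₁ h₂ =>
      have := add_mem h₁ h₂
      rwa [sub_add_sub_comm, ← map_add, ← TensorProduct.tmul_add, ← map_add,
        ← TensorProduct.tmul_add] at this
    | tmul w z => exact Submodule.subset_span ⟨u, β (x ⊗ₜ w), z, rfl⟩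
  have key2 : ∀ c : F ⊗[Cx R] E,
      TensorProduct.map (σ c) LinearMap.id t ∈ balancing F.toBimod E.toBimod := by
    intro c
    induction c using TensorProduct.induction_on with
    | zero => simp
    | add c₁ c₂ h₁ h₂ =>
      rw [map_add, TensorProduct.map_add_left]
      exact add_mem h₁ h₂
    | tmul u x => simpa [hp x] using key u x t
  obtain ⟨c, hc⟩ := hα.surj 1
  have hl : ∀ w : F, leftMap α (TensorProduct.assoc (Cx R) F E F (c ⊗ₜ w)) = w := fun w => by
    rw [leftMap_assoc, hc, one_smul]
  have hinj : Function.Injective (σ c) := by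
    rw [injective_iff_map_eq_zero]
    intro w hw
    rw [hσ', ← leftMap_eq_zero_iff hβ hα, hl] at hw
    exact hw
  have hsurj : Function.Surjective (σ c) := by
    intro v
    obtain ⟨s, rfl⟩ := rightMap_surjective hβ v
    refine ⟨leftMap α s, ?_⟩
    rw [hσ', ← sub_eq_zero, ← map_sub, ← leftMap_eq_zero_iff hβ hα, map_sub, hl, sub_self]
  let e := LinearEquiv.ofBijective (σ c) ⟨hinj, hsurj⟩
  have he : ∀ (v : F) (b : B), e.symm (v <• b) = e.symm v <• b := by
    intro v b
    apply e.injective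
    have := hσr c (e.symm v) b
    change e (e.symm v <• b) = e (e.symm v) <• b at this
    rw [this, e.apply_symm_apply, e.apply_symm_apply]
  have hmap : ∀ s ∈ balancing F.toBimod E.toBimod,
      TensorProduct.map e.symm.toLinearMap LinearMap.id s ∈ balancing F.toBimod E.toBimod := by
    intro s hs
    refine (Submodule.span_le (p := (balancing F.toBimod E.toBimod).comap
      (TensorProduct.map e.symm.toLinearMap LinearMap.id))).2 ?_ hs
    rintro _ ⟨y, b, x, rfl⟩
    refine Submodule.subset_span ⟨e.symm y, b, x, ?_⟩
    simp [he]
  have := hmap _ (key2 c)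
  rw [← LinearMap.comp_apply, ← TensorProduct.map_comp] at this
  have hid : e.symm.toLinearMap ∘ₗ σ c = LinearMap.id := by
    ext w
    exact e.symm_apply_apply w
  rwa [hid, LinearMap.comp_id, TensorProduct.map_id, LinearMap.id_apply] at this

theorem IsRegularPairing.tensorIso {F : PreHilbertBimod R A B} {E : PreHilbertBimod R B A}
    {α : F ⊗[Cx R] E →ₗ[Cx R] A} {β : E ⊗[Cx R] F →ₗ[Cx R] B}
    (hα : IsRegularPairing F E α) (hβ : IsRegularPairing E F β) :
    TensorIso F.toBimod E.toBimod (Bimod.regular (Cx R) A) := by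
  let f : BalancedTensor F.toBimod E.toBimod →ₗ[Cx R] A :=
    (balancing F.toBimod E.toBimod).liftQ α fun t ht => hα.balanced t ht
  have hf : ∀ t, f ((balancing F.toBimod E.toBimod).mkQ t) = α t := fun t => rfl
  have hbij : Function.Bijective f := by
    constructor
    · rw [injective_iff_map_eq_zero]
      intro q hq
      obtain ⟨t, rfl⟩ := Submodule.mkQ_surjective _ q
      rw [Submodule.mkQ_apply, Submodule.Quotient.mk_eq_zero]
      exact hα.ker_le hβ t hq
    · intro a
      obtain ⟨t, rfl⟩ := hα.surj a
      exact ⟨_, hf t⟩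
  exact ⟨LinearEquiv.ofBijective f hbij, hα.left, hα.right⟩

/-- The bimodule underlying an invertible pre-Hilbert bimodule is invertible. -/
theorem PreHilbertBimod.IsInvertible.toBimod {E : PreHilbertBimod R B A} (h : E.IsInvertible) :
    E.toBimod.IsInvertible := by
  obtain ⟨F, h1, h2⟩ := h
  obtain ⟨α, hα⟩ := h1.exists_pairing
  obtain ⟨β, hβ⟩ := h2.exists_pairing
  exact ⟨F.toBimod, hα.tensorIso hβ, hβ.tensorIso hα⟩

/-- The canonical map `StrPic(B, A) → Pic(B, A)` which forgets inner products. -/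
def strPicToPic (R : Type w) (B A : Type u)
    [CommRing R] [LinearOrder R] [IsStrictOrderedRing R]
    [Ring B] [StarRing B] [Algebra (Cx R) B] [Ring A] [StarRing A] [Algebra (Cx R) A] :
    StrPic R B A → Pic (Cx R) B A :=
  Quotient.map' (fun E => ⟨E.1.toBimod, E.2.toBimod⟩)
    (fun _ _ ⟨φ, h1, h2, _⟩ => ⟨φ, h1, h2⟩)

end PreHilbert

/-! ## The conditions on the algebras -/

section Conditions

/-- Condition (I): `1 + M* M` is invertible for every square matrix `M` over `A`. -/
def CondI (A : Type u) [Ring A] [StarRing A] : Prop :=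
  ∀ (n : ℕ) (M : Matrix (Fin n) (Fin n) A), IsUnit (1 + star M * M)

/-- Condition (II⁻): every positive invertible `H ∈ Mₙ(A)` commuting with a projection `P` is
`U* U` for an invertible `U` commuting with `P`. -/
def CondIIMinus (R : Type w) (A : Type u) [CommRing R] [LinearOrder R] [IsStrictOrderedRing R]
    [Ring A] [StarRing A] [Algebra (Cx R) A] : Prop :=
  ∀ (n : ℕ) (H P : Matrix (Fin n) (Fin n) A), IsPositive R H → IsUnit H → IsStarProjection P →
    Commute P H → ∃ U : Matrix (Fin n) (Fin n) A, IsUnit U ∧ H = star U * U ∧ Commute P U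

/-- The `*`-algebra `P D P` for a projection `P` of `D`. -/
def corner (S : Type w) {D : Type u} [CommRing S] [Ring D] [StarRing D] [Algebra S D]
    {P : D} (hP : IsStarProjection P) : NonUnitalStarSubalgebra S D where
  carrier := {M | P * M = M ∧ M * P = M}
  add_mem' := fun ⟨h1, h2⟩ ⟨k1, k2⟩ => ⟨by rw [mul_add, h1, k1], by rw [add_mul, h2, k2]⟩
  zero_mem' := ⟨mul_zero P, zero_mul P⟩
  mul_mem' := fun ⟨h1, _⟩ ⟨_, k2⟩ => ⟨by rw [← mul_assoc, h1], by rw [mul_assoc, k2]⟩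
  smul_mem' := fun c _ ⟨h1, h2⟩ => ⟨by rw [mul_smul_comm, h1], by rw [smul_mul_assoc, h2]⟩
  star_mem' := fun {M} ⟨h1, h2⟩ => by
    have hs : star P = P := hP.isSelfAdjoint
    exact ⟨by rw [← hs, ← star_mul, h2], by rw [← hs, ← star_mul, h1]⟩

/-- Condition (III) for the pair `A`, `B`: if `B` and `P Mₙ(A) P` (whose unit is `P`), for a
projection `P ∈ Mₙ(A)`, are isomorphic as unital algebras, then they are `*`-isomorphic. A
multiplicative bijection of unital algebras preserves the units. -/
def CondIII (S : Type w) (A B : Type u) [CommRing S]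
    [Ring A] [StarRing A] [Algebra S A] [Ring B] [StarRing B] [Algebra S B] : Prop :=
  ∀ (n : ℕ) (P : Matrix (Fin n) (Fin n) A) (hP : IsStarProjection P),
    (∃ φ : B ≃+* corner S hP, ∀ (c : S) (b : B), φ (c • b) = c • φ b) →
      Nonempty (B ≃⋆ₐ[S] corner S hP)

/-- Condition (IV): for every algebra automorphism `Φ` there is an invertible `U` with
`Φ* ∘ Φ⁻¹ = Ad (U* U)`, where `Φ*(b) = Φ(b*)*` and `Ad (V) b = V b V⁻¹`. -/
def CondIV (S : Type w) (B : Type u) [CommRing S] [Ring B] [StarRing B] [Algebra S B] : Prop :=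
  ∀ Φ : B ≃ₐ[S] B, ∃ U : Bˣ, ∀ b : B,
    star (Φ (star (Φ.symm b))) = ↑(star U * U) * b * ↑(star U * U)⁻¹

end Conditions

end StrongMorita

/-! Everything is read off in coordinates. An invertible bimodule `E` is a finitely generated
projective generator over `A`, and `B` is its full algebra of right linear endomorphisms. A frame
eᵢ, fᵢ with x = ∑ eᵢ fᵢ(x) identifies `B` with the corner Q Mₙ(A) Q, where Q = `mat 1` is
idempotent, and (I) lets Q be taken to be a projection P.

If (IV) holds: (III) supplies a `*`-isomorphism ψ of `B` onto the corner. The coordinate isomorphism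
is ψ ∘ Φ for an automorphism Φ of `B`, and the `U` that (IV) gives for Φ conjugates it into a
`*`-homomorphism (`exists_isHermitian`). Then ∑ fᵢ(x)* fᵢ(y) is an inner product on the given
bimodule, compatible with both actions. Its inverse is the conjugate bimodule with rank one
operators as inner product. For this, 1 ∈ `A` must be a sum of squares ⟨y, y⟩, which follows from
(I) and (II⁻) because `E` is a generator (`exists_sum_inner_self`).

If the map is surjective: take a strong equivalence bimodule `E` and a lift `G` of its twist by Φ.
As right modules they coincide. By (II⁻), including its commutation clause, both inner products are
standard up to an invertible element of the corner (`exists_inner_eq_mulVec`), so that of `G` is ⟨x,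
U*U y⟩ in terms of that of `E`, with `U` invertible in `B`. Left multiplication is adjointable for
both inner products, and comparing the two adjoints is exactly Φ* ∘ Φ⁻¹ = Ad(U*U). -/

namespace StrongMorita

open scoped TensorProduct RightActions

/-! ### Idempotents, projections and invertibility under (I). -/

section Matrices

variable {A : Type u} [Ring A] [StarRing A]

theorem CondI.isUnit (hI : CondI A) {ι : Type*} [Fintype ι] [DecidableEq ι]
    (M : Matrix ι ι A) : IsUnit (1 + star M * M) := by
  let e := Fintype.equivFin ι
  have h := hI _ (M.submatrix e.symm e.symm)
  have h2 : (1 + star M * M) =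
      (Matrix.reindexRingEquiv A e.symm) (1 + star (M.submatrix e.symm e.symm) *
        M.submatrix e.symm e.symm) := by
    rw [map_add, map_one, map_mul]
    congr 1
    congr 1
    · ext i j
      simp [Matrix.star_apply]
    · ext i j
      simp
  rw [h2]
  exact h.map _

/-- The positive element `1 + (Q - Q*)* (Q - Q*)` intertwines an idempotent `Q` as follows. -/
theorem mul_one_add_star_mul_self {D : Type*} [Ring D] [StarRing D] {Q : D}
    (hQ : IsIdempotentElem Q) :
    Q * (1 + star (Q - star Q) * (Q - star Q)) = Q * star Q * Q ∧
      (1 + star (Q - star Q) * (Q - star Q)) * Q = Q * star Q * Q := by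
  have h1 : Q * Q = Q := hQ
  have h2 : star Q * star Q = star Q := by rw [← star_mul, h1]
  have h3 : 1 + star (Q - star Q) * (Q - star Q) =
      1 - Q - star Q + Q * star Q + star Q * Q := by
    rw [star_sub, star_star]
    noncomm_ring
    rw [h1, h2]
    abel
  rw [h3]
  constructor
  · simp only [mul_add, mul_sub, mul_one, ← mul_assoc, h1]
    abel
  · simp only [add_mul, sub_mul, one_mul, mul_assoc, h1]
    abel

/-- Kaplansky's trick: an idempotent has the range of a projection. -/
theorem exists_projection {D : Type*} [Ring D] [StarRing D] {Q : D}
    (hQ : IsIdempotentElem Q) (hZ : IsUnit (1 + star (Q - star Q) * (Q - star Q))) :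
    ∃ P : D, IsStarProjection P ∧ P * Q = Q ∧ Q * P = P := by
  obtain ⟨h1, h2⟩ := mul_one_add_star_mul_self hQ
  obtain ⟨Z, hZ⟩ := hZ
  have hs : star (Z : D) = Z := by
    rw [hZ]; simp [star_mul]
  rw [← hZ] at h1 h2
  have hQQ : Q * Q = Q := hQ
  have hc : Commute Q (Z : D) := h1.trans h2.symm
  have hc' : Commute (star Q) (Z : D) := by
    have := hc.star_star
    rwa [hs] at this
  have hi : Commute Q ↑Z⁻¹ := hc.units_inv_right
  have hi' : Commute (star Q) ↑Z⁻¹ := hc'.units_inv_right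
  have hsi : star (↑Z⁻¹ : D) = ↑Z⁻¹ := by
    have : star Z = Z := Units.ext hs
    rw [← Units.coe_star, star_inv, this]
  -- The projection is P = Q Q* Z⁻¹. Since Z is self-adjoint and commutes with Q and Q*, so is P
  -- self-adjoint, and QQ*Q = QZ gives PQ = Q, whence P² = P.
  have hPQ : Q * star Q * ↑Z⁻¹ * Q = Q := by
    rw [mul_assoc, ← hi.eq, ← mul_assoc, ← h1, mul_assoc, Z.mul_inv, mul_one]
  refine ⟨Q * star Q * ↑Z⁻¹, ⟨?_, ?_⟩, hPQ, ?_⟩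
  · change Q * star Q * ↑Z⁻¹ * (Q * star Q * ↑Z⁻¹) = _
    rw [← mul_assoc, ← mul_assoc, hPQ]
  · change star _ = _
    rw [star_mul, star_mul, star_star, hsi, ← mul_assoc, ← hi.eq, mul_assoc, ← hi'.eq, mul_assoc]
  · rw [← mul_assoc, ← mul_assoc, hQQ]

/-- If a column `T` has a left inverse `S*`, then `T* T` is invertible. -/
theorem CondI.isUnit_sum (hI : CondI A) {ι : Type*} [Fintype ι] (s t : ι → A)
    (h : ∑ i, star (s i) * t i = 1) : IsUnit (∑ i, star (t i) * t i) := by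
  classical
  let S : Matrix ι Unit A := Matrix.of fun i _ => s i
  let T : Matrix ι Unit A := Matrix.of fun i _ => t i
  have hST : S.conjTranspose * T = 1 := by
    ext i j
    simpa [Matrix.mul_apply, S, T] using h
  let Q : Matrix ι ι A := T * S.conjTranspose
  have hQ : IsIdempotentElem Q := by
    change T * S.conjTranspose * (T * S.conjTranspose) = T * S.conjTranspose
    rw [Matrix.mul_assoc, ← Matrix.mul_assoc S.conjTranspose, hST, Matrix.one_mul]
  obtain ⟨h1, h2⟩ := mul_one_add_star_mul_self hQ
  obtain ⟨Z, hZ⟩ := hI.isUnit (Q - star Q)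
  rw [← hZ] at h1 h2
  have hc : Commute Q (Z : Matrix ι ι A) := h1.trans h2.symm
  have hi : Commute Q ↑Z⁻¹ := hc.units_inv_right
  have hSQ : S.conjTranspose * Q = S.conjTranspose := by
    change S.conjTranspose * (T * S.conjTranspose) = _
    rw [← Matrix.mul_assoc, hST, Matrix.one_mul]
  have hQT : Q * T = T := by
    change T * S.conjTranspose * T = _
    rw [Matrix.mul_assoc, hST, Matrix.mul_one]
  have hQs : star Q = S * T.conjTranspose := by
    change (T * S.conjTranspose).conjTranspose = _
    rw [Matrix.conjTranspose_mul, Matrix.conjTranspose_conjTranspose]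
  -- `S* Z T = (S* S) (T* T)`
  have e1 : S.conjTranspose * (Z : Matrix ι ι A) * T =
      (S.conjTranspose * S) * (T.conjTranspose * T) := by
    calc S.conjTranspose * (Z : Matrix ι ι A) * T
        = S.conjTranspose * (Q * (Z : Matrix ι ι A)) * T := by
          rw [← Matrix.mul_assoc S.conjTranspose, hSQ]
      _ = S.conjTranspose * Q * star Q * (Q * T) := by
          rw [h1]; simp only [Matrix.mul_assoc]
      _ = _ := by rw [hSQ, hQT, hQs]; simp only [Matrix.mul_assoc]
  -- Z commutes with Q = TS*, so S*Z⁻¹T is a left inverse of S*ZT = (S*S)(T*T), and T*T gets a left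
  -- inverse.
  have e2 : S.conjTranspose * (↑Z⁻¹ : Matrix ι ι A) * T *
      (S.conjTranspose * (Z : Matrix ι ι A) * T) = 1 := by
    calc S.conjTranspose * (↑Z⁻¹ : Matrix ι ι A) * T * (S.conjTranspose * (Z : Matrix ι ι A) * T)
        = S.conjTranspose * ((↑Z⁻¹ : Matrix ι ι A) * (Q * (Z : Matrix ι ι A))) * T := by
          simp only [Matrix.mul_assoc, Q]
      _ = S.conjTranspose * Q * T := by
          rw [hc.eq, ← Matrix.mul_assoc (↑Z⁻¹ : Matrix ι ι A), Z.inv_mul, Matrix.one_mul]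
      _ = 1 := by rw [hSQ, hST]
  have hl : (S.conjTranspose * (↑Z⁻¹ : Matrix ι ι A) * T * (S.conjTranspose * S)) *
      (T.conjTranspose * T) = 1 := by
    rw [Matrix.mul_assoc, ← e1, e2]
  have hsum : (T.conjTranspose * T) () () = ∑ i, star (t i) * t i := by
    simp [Matrix.mul_apply, T]
  set k := (S.conjTranspose * (↑Z⁻¹ : Matrix ι ι A) * T * (S.conjTranspose * S)) () () with hk
  have hl' : k * ∑ i, star (t i) * t i = 1 := by
    have := congrFun (congrFun hl ()) ()
    rw [Matrix.mul_apply] at this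
    simpa [← hk, hsum] using this
  -- For a self-adjoint element the adjoint of a left inverse is a right inverse.
  have hsa : star (∑ i, star (t i) * t i) = ∑ i, star (t i) * t i := by
    simp [star_sum]
  have hr' : (∑ i, star (t i) * t i) * star k = 1 := by
    rw [← hsa, ← star_mul, hl', star_one]
  exact isUnit_iff_exists_and_exists.2 ⟨⟨_, hr'⟩, ⟨_, hl'⟩⟩

end Matrices

/-! ### Positive elements and Gram matrices. -/

section Positivity

variable {R : Type w} [CommRing R] [LinearOrder R]
  {A : Type u} [Ring A] [StarRing A] [Algebra (Cx R) A]

theorem isPositive_star_mul_self (a : A) : IsPositive R (star a * a) := fun _ hω => hω a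

theorem IsPositive.zero : IsPositive R (0 : A) := fun ω _ => by
  rw [map_zero]; exact ⟨rfl, le_rfl⟩

variable [IsStrictOrderedRing R]

theorem IsPositive.add {a b : A} (ha : IsPositive R a) (hb : IsPositive R b) :
    IsPositive R (a + b) := fun ω hω => by
  obtain ⟨h1, h2⟩ := ha ω hω
  obtain ⟨h3, h4⟩ := hb ω hω
  rw [map_add]
  exact ⟨by rw [QuadraticAlgebra.im_add, h1, h3, add_zero],
    by rw [QuadraticAlgebra.re_add]; exact add_nonneg h2 h4⟩

theorem IsPositive.sum {ι : Type*} (s : Finset ι) {a : ι → A} (h : ∀ i ∈ s, IsPositive R (a i)) :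
    IsPositive R (∑ i ∈ s, a i) :=
  Finset.sum_induction a (IsPositive R) (fun _ _ => IsPositive.add) IsPositive.zero h

/-- A sum of the matrices `(vᵢ* vⱼ)` is positive. -/
theorem isPositive_gram {ι : Type*} (s : Finset ι) {n : ℕ} (v : ι → Fin n → A) :
    IsPositive R (Matrix.of fun i j => ∑ k ∈ s, star (v k i) * v k j) := by
  have h : (Matrix.of fun i j => ∑ k ∈ s, star (v k i) * v k j) =
      ∑ k ∈ s, Matrix.of fun i j => star (v k i) * v k j := by
    ext i j
    simp [Matrix.sum_apply]
  rw [h]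
  exact IsPositive.sum s fun k _ => (PreHilbertBimod.regular R A).completelyPositive n (v k)

end Positivity

/-! ### Morita theory of invertible bimodules. -/

section Morita

theorem exists_sum_tmul {S M N : Type*} [CommRing S] [AddCommGroup M] [Module S M]
    [AddCommGroup N] [Module S N] (t : M ⊗[S] N) :
    ∃ (n : ℕ) (y : Fin n → M) (x : Fin n → N), t = ∑ k, y k ⊗ₜ[S] x k := by
  obtain ⟨s, hs⟩ := TensorProduct.exists_finset t
  refine ⟨s.card, fun k => (s.equivFin.symm k).1.1, fun k => (s.equivFin.symm k).1.2, ?_⟩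
  rw [hs, ← Finset.sum_coe_sort, ← Equiv.sum_comp s.equivFin.symm]

variable {S : Type w} [CommRing S]
  {A B : Type u} [Ring A] [Algebra S A] [Ring B] [Algebra S B]

/-- A finite family of vectors and of right linear functionals with `x = ∑ eᵢ fᵢ(x)`. -/
structure Frame (E : Bimod S B A) (n : ℕ) where
  vec : Fin n → E
  coord : Fin n → E →ₗ[Aᵐᵒᵖ] A
  sum_vec : ∀ x, ∑ i, vec i <• coord i x = x

/-- The left action is an isomorphism onto the right linear endomorphisms. -/
structure Bimod.IsFullLeft (E : Bimod S B A) : Prop where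
  faithful : ∀ b : B, (∀ x : E, b • x = 0) → b = 0
  exists_smul : ∀ T : E →ₗ[Aᵐᵒᵖ] E, ∃ b : B, ∀ x, T x = b • x

/-- The right linear functionals generate `A`. -/
def Bimod.IsGenerator (E : Bimod S B A) : Prop :=
  ∃ (n : ℕ) (g : Fin n → E →ₗ[Aᵐᵒᵖ] A) (x : Fin n → E), ∑ k, g k (x k) = 1

/-- An isomorphism `F ⊗ E ≅ A` as a universal balanced pairing `F × E → A`. -/
theorem TensorIso.exists_pairing {F : Bimod S A B} {E : Bimod S B A}
    (h : TensorIso F E (Bimod.regular S A)) :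
    ∃ α : F → E →ₗ[Aᵐᵒᵖ] A,
      (∀ x y y', α (y + y') x = α y x + α y' x) ∧
      (∀ (a : A) y x, α (a • y) x = a * α y x) ∧
      (∀ y (b : B) x, α (y <• b) x = α y (b • x)) ∧
      (∃ (n : ℕ) (y : Fin n → F) (x : Fin n → E), ∑ k, α (y k) (x k) = 1) ∧
      ∀ (G : Type u) [AddCommGroup G] [Module S G] (γ : F →ₗ[S] E →ₗ[S] G),
        (∀ y (b : B) x, γ (y <• b) x = γ y (b • x)) →
        ∃ δ : A →+ G, ∀ y x, γ y x = δ (α y x) := by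
  obtain ⟨φ, h1, h2⟩ := h
  let a : F → E → A := fun y x => φ ((balancing F E).mkQ (y ⊗ₜ[S] x))
  refine ⟨fun y =>
    { toFun := a y
      map_add' := fun x x' => ?_
      map_smul' := fun c x => h2 y x c.unop }, fun x y y' => ?_, h1, fun y b x => ?_, ?_, ?_⟩
  · simp only [a, TensorProduct.tmul_add, map_add]
    rfl
  · change a _ _ = a _ _ + a _ _
    simp only [a, TensorProduct.add_tmul, map_add]
    rfl
  · change φ _ = φ _
    congr 1
    rw [← sub_eq_zero, ← map_sub, Submodule.mkQ_apply, Submodule.Quotient.mk_eq_zero]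
    exact Submodule.subset_span ⟨y, b, x, rfl⟩
  · obtain ⟨q, hq⟩ := φ.surjective (1 : A)
    obtain ⟨t, rfl⟩ := Submodule.mkQ_surjective _ q
    obtain ⟨n, y, x, rfl⟩ := exists_sum_tmul t
    refine ⟨n, y, x, ?_⟩
    rw [map_sum, map_sum] at hq
    exact hq
  · intro G _ _ γ hγ
    let g : BalancedTensor F E →ₗ[S] G := (balancing F E).liftQ (TensorProduct.lift γ) <| by
      refine Submodule.span_le.2 ?_
      rintro _ ⟨y, b, x, rfl⟩
      simp [hγ]
    refine ⟨(g ∘ₗ φ.symm.toLinearMap).toAddMonoidHom, fun y x => ?_⟩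
    change _ = g (φ.symm (φ _))
    rw [φ.symm_apply_apply]
    rfl

/-- An invertible bimodule is finitely generated projective and a generator as a right module, and
the left action is by all of its right linear endomorphisms. -/
theorem Bimod.IsInvertible.morita {E : Bimod S B A} (h : E.IsInvertible) :
    (∃ n, Nonempty (Frame E n)) ∧ E.IsFullLeft ∧ E.IsGenerator := by
  obtain ⟨F, h1, h2⟩ := h
  obtain ⟨α, αadd, αl, αb, ⟨n, y, v, hα⟩, αu⟩ := h1.exists_pairing
  obtain ⟨β, βadd, βl, βb, ⟨m, u, w, hβ⟩, -⟩ := h2.exists_pairing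
  -- The two pairings are chosen independently, so β(x, w)z need not equal xα(w, z). For fixed x the
  -- former is balanced in (w, z), hence factors through α.
  have hδ : ∀ x : E, ∃ δ : A →+ E, ∀ w z, β x w • z = δ (α w z) := fun x => by
    refine αu E (LinearMap.mk₂ S (fun (w : F) (z : E) => β x w • z) ?_ ?_ ?_ ?_) ?_
    · intro w w' z
      rw [map_add, add_smul]
    · intro c w z
      rw [LinearMap.map_smul_of_tower, smul_assoc]
    · intro w z z'
      rw [smul_add]
    · intro c w z
      rw [← algebraMap_smul B c z, smul_smul, ← Algebra.commutes, ← smul_smul, algebraMap_smul]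
    · intro w b z
      change β x (w <• b) • z = β x w • b • z
      rw [map_smul, smul_smul]
      rfl
  choose δ hδ using hδ
  have hδa : ∀ x a, δ x a = δ (x <• a) 1 := by
    intro x a
    have h : ∀ w z, δ x (a * α w z) = δ (x <• a) (α w z) := fun w z => by
      rw [← αl, ← hδ, ← hδ, βb]
    calc δ x a = ∑ k, δ x (a * α (y k) (v k)) := by rw [← map_sum, ← Finset.mul_sum, hα, mul_one]
      _ = δ (x <• a) 1 := by simp only [h]; rw [← map_sum, hα]
  -- the failure of `α` and `β` to be associative is an automorphism `θ`
  let θ : E → E := fun x => δ x 1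
  have hθ : ∀ x w z, β x w • z = θ (x <• α w z) := fun x w z => by rw [hδ, hδa]
  have θadd : ∀ x x', θ (x + x') = θ x + θ x' := by
    intro x x'
    have h : ∀ w z, δ (x + x') (α w z) = δ x (α w z) + δ x' (α w z) := fun w z => by
      rw [← hδ, ← hδ, ← hδ, βadd, add_smul]
    calc θ (x + x') = ∑ k, δ (x + x') (α (y k) (v k)) := by rw [← map_sum, hα]
      _ = θ x + θ x' := by simp only [h]; rw [Finset.sum_add_distrib, ← map_sum, ← map_sum, hα]
  have θr : ∀ x (a : A), θ (x <• a) = θ x <• a := by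
    intro x a
    calc θ (x <• a) = δ x (∑ k, α (y k) (v k) * a) := by
          rw [← Finset.sum_mul, hα, one_mul]; exact (hδa x a).symm
      _ = ∑ k, δ x (α (y k) (v k <• a)) := by
          rw [map_sum]
          exact Finset.sum_congr rfl fun k _ => congrArg _ ((α (y k)).map_smul _ _).symm
      _ = ∑ k, δ x (α (y k) (v k)) <• a := by
          refine Finset.sum_congr rfl fun k _ => ?_
          rw [← hδ, ← hδ, smul_comm]
      _ = θ x <• a := by rw [← Finset.smul_sum, ← map_sum, hα]
  -- Letting 1 = ∑ β(uₖ, wₖ) act on z gives the frame θ(uₖ), α(wₖ, ·).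
  have hrec : ∀ z, ∑ k, θ (u k) <• α (w k) z = z := fun z => by
    simp only [← θr, ← hθ]
    rw [← Finset.sum_smul, hβ, one_smul]
  let θ' : E →+ E := AddMonoidHom.mk' θ θadd
  have θsurj : ∀ z, ∃ x, θ x = z := fun z => by
    refine ⟨∑ k, u k <• α (w k) z, ?_⟩
    change θ' _ = z
    rw [map_sum]
    exact (Finset.sum_congr rfl fun k _ => θr _ _).trans (hrec z)
  refine ⟨⟨m, ⟨⟨fun k => θ (u k), fun k => α (w k), hrec⟩⟩⟩, ⟨fun b hb => ?_, fun T => ?_⟩,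
    ⟨n, fun k => α (y k), v, hα⟩⟩
  · rw [← mul_one b, ← hβ, Finset.mul_sum]
    refine Finset.sum_eq_zero fun k _ => ?_
    rw [← βl, hb]
    have := βadd (w k) 0 0
    simpa using this
  -- T is determined by its values on the frame; writing these as θ(xₖ) turns ∑ T(θ(uₖ)) α(wₖ, z)
  -- into ∑ β(xₖ, wₖ) z.
  · choose x hx using fun k => θsurj (T (θ (u k)))
    refine ⟨∑ k, β (x k) (w k), fun z => ?_⟩
    rw [Finset.sum_smul]
    simp only [hθ, θr, hx]
    conv_lhs => rw [← hrec z]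
    rw [map_sum]
    simp only [map_smul]

end Morita

/-! ### Coordinates: a frame represents `B` as a matrix corner. -/

section Frames

variable {S : Type w} [CommRing S]
  {A B : Type u} [Ring A] [Algebra S A] [Ring B] [Algebra S B]

namespace Frame

variable {E : Bimod S B A} {n : ℕ} (F : Frame E n)

/-- The column of coordinates of a vector. -/
def col (x : E) : Fin n → A := fun i => F.coord i x

/-- The combination of the frame vectors with given coefficients. -/
def comb (v : Fin n → A) : E := ∑ i, F.vec i <• v i

/-- The matrix of the left action of `b`. -/
def mat (b : B) : Matrix (Fin n) (Fin n) A := Matrix.of fun i j => F.coord i (b • F.vec j)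

@[simp] theorem comb_col (x : E) : F.comb (F.col x) = x := F.sum_vec x

theorem comb_single (i : Fin n) : F.comb (Pi.single i 1) = F.vec i := by
  rw [comb, Finset.sum_eq_single i]
  · simp
  · intro j _ hj
    simp [hj]
  · simp

theorem col_add (x y : E) : F.col (x + y) = F.col x + F.col y := by
  ext i; simp [col]

theorem col_action (x : E) (a : A) (i : Fin n) : F.col (x <• a) i = F.col x i * a := by
  simp [col]

theorem col_smul_scalar (c : S) (x : E) : F.col (c • x) = c • F.col x := by
  ext i
  exact LinearMap.map_smul_of_tower _ c x

theorem comb_add (v v' : Fin n → A) : F.comb (v + v') = F.comb v + F.comb v' := by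
  simp [comb, add_smul, Finset.sum_add_distrib]

theorem comb_action (v : Fin n → A) (a : A) : F.comb (fun i => v i * a) = F.comb v <• a := by
  simp [comb, mul_smul, Finset.smul_sum]

theorem col_smul_comb (b : B) (v : Fin n → A) : F.col (b • F.comb v) = (F.mat b).mulVec v := by
  ext i
  simp only [col, comb, Finset.smul_sum, map_sum, mat, Matrix.mulVec, dotProduct, Matrix.of_apply]
  refine Finset.sum_congr rfl fun j _ => ?_
  rw [smul_comm, map_smul]
  rfl

theorem col_smul (b : B) (x : E) : F.col (b • x) = (F.mat b).mulVec (F.col x) := by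
  rw [← col_smul_comb, comb_col]

theorem comb_mulVec (b : B) (v : Fin n → A) : F.comb ((F.mat b).mulVec v) = b • F.comb v := by
  rw [← col_smul_comb, comb_col]

/-- Frame vectors may be dependent: coordinate columns fill only the range of the idempotent, so
coefficients are recovered only up to it. -/
theorem col_comb (v : Fin n → A) : F.col (F.comb v) = (F.mat 1).mulVec v := by
  rw [← col_smul_comb, one_smul]

theorem mat_one_col (x : E) : (F.mat 1).mulVec (F.col x) = F.col x := by
  rw [← col_smul, one_smul]

theorem mat_mul (b c : B) : F.mat (b * c) = F.mat b * F.mat c := by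
  refine Matrix.ext_of_mulVec_single fun j => ?_
  rw [← col_smul_comb, ← Matrix.mulVec_mulVec, ← col_smul_comb, ← col_smul_comb, comb_col, mul_smul]

theorem mat_add (b c : B) : F.mat (b + c) = F.mat b + F.mat c := by
  ext i j
  simp [mat, add_smul]

theorem mat_smul (s : S) (b : B) : F.mat (s • b) = s • F.mat b := by
  ext i j
  simp only [mat, Matrix.of_apply, Matrix.smul_apply, smul_assoc]
  exact LinearMap.map_smul_of_tower _ s _

theorem isIdempotentElem_mat_one : IsIdempotentElem (F.mat 1) := by
  change F.mat 1 * F.mat 1 = _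
  rw [← mat_mul, one_mul]

theorem mat_one_mul (b : B) : F.mat 1 * F.mat b = F.mat b := by rw [← mat_mul, one_mul]

theorem mat_mul_one (b : B) : F.mat b * F.mat 1 = F.mat b := by rw [← mat_mul, mul_one]

theorem mat_injective (hE : E.IsFullLeft) : Function.Injective F.mat := by
  intro b c h
  rw [← sub_eq_zero]
  refine hE.faithful _ fun x => ?_
  rw [sub_smul, sub_eq_zero, ← F.comb_col x, ← comb_mulVec, h, comb_mulVec]

/-- Every matrix in the corner of `mat 1` comes from `B`. -/
theorem exists_mat_eq (hE : E.IsFullLeft) (M : Matrix (Fin n) (Fin n) A)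
    (h1 : F.mat 1 * M = M) (h2 : M * F.mat 1 = M) : ∃ b, F.mat b = M := by
  let T : E →ₗ[Aᵐᵒᵖ] E :=
    { toFun := fun x => F.comb (M.mulVec (F.col x))
      map_add' := fun x y => by rw [col_add, Matrix.mulVec_add, comb_add]
      map_smul' := fun a x => by
        rw [RingHom.id_apply, ← MulOpposite.op_unop a, ← comb_action]
        congr 1
        ext i
        simp only [Matrix.mulVec, dotProduct, col_action, Finset.sum_mul, mul_assoc] }
  obtain ⟨b, hb⟩ := hE.exists_smul T
  refine ⟨b, Matrix.ext_of_mulVec_single fun j => ?_⟩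
  rw [← col_smul_comb, ← hb]
  change F.col (F.comb (M.mulVec (F.col (F.comb _)))) = _
  rw [col_comb, col_comb, Matrix.mulVec_mulVec, Matrix.mulVec_mulVec, h1, h2]

/-- The frame `V f`, `e W`. -/
def change (V W : Matrix (Fin n) (Fin n) A) (h : W * V * F.mat 1 = F.mat 1) : Frame E n where
  vec j := F.comb fun i => W i j
  coord i :=
    { toFun := fun x => V.mulVec (F.col x) i
      map_add' := fun x y => by rw [col_add, Matrix.mulVec_add]; rfl
      map_smul' := fun a x => by
        obtain ⟨a, rfl⟩ := MulOpposite.op_surjective a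
        simp only [Matrix.mulVec, dotProduct, col_action, RingHom.id_apply,
          op_smul_eq_mul, Finset.sum_mul, mul_assoc] }
  sum_vec x := by
    have h1 : ∀ v : Fin n → A, ∑ j, F.comb (fun i => W i j) <• v j = F.comb (W.mulVec v) := by
      intro v
      have h2 : W.mulVec v = ∑ j, fun i => W i j * v j := by
        ext i
        rw [Finset.sum_apply]
        rfl
      simp only [← comb_action]
      rw [h2]
      exact (map_sum (AddMonoidHom.mk' F.comb F.comb_add) _ _).symm
    change ∑ j, F.comb (fun i => W i j) <• (V.mulVec (F.col x)) j = x
    rw [h1, Matrix.mulVec_mulVec, ← F.mat_one_col, Matrix.mulVec_mulVec, h, mat_one_col, comb_col]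

/-- The tool for every normalization of a frame below: making its idempotent self-adjoint, its
representation hermitian, or its inner product standard. -/
theorem change_mat (V W : Matrix (Fin n) (Fin n) A) (h : W * V * F.mat 1 = F.mat 1) (b : B) :
    (F.change V W h).mat b = V * F.mat b * W := by
  ext i j
  change V.mulVec (F.col (b • F.comb fun i => W i j)) i = _
  rw [col_smul_comb, Matrix.mulVec_mulVec]
  rfl

/-- Under condition (I), the coordinates of a frame can be kept so that its idempotent becomes
self-adjoint. -/
theorem exists_isStarProjection [StarRing A] (F : Frame E n) (hI : CondI A) :
    ∃ F' : Frame E n, IsStarProjection (F'.mat 1) := by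
  obtain ⟨P, hP, h1, h2⟩ := exists_projection F.isIdempotentElem_mat_one (hI _ _)
  -- With V = 1 and W = P, reconstruction needs PQ = Q, and the new idempotent is QP = P.
  refine ⟨F.change 1 P (by rw [mul_one, h1]), ?_⟩
  rwa [change_mat, one_mul, h2]

/-- Transport along an isomorphism of right modules. -/
def map {C : Type u} [Ring C] [Algebra S C] {G : Bimod S C A} (e : E ≃ₗ[Aᵐᵒᵖ] G) : Frame G n where
  vec i := e (F.vec i)
  coord i := F.coord i ∘ₗ e.symm.toLinearMap
  sum_vec x := by
    apply e.symm.injective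
    simp only [map_sum, map_smul, e.symm_apply_apply]
    exact F.sum_vec (e.symm x)

/-- The matrix algebra isomorphism of `B` onto the corner of a frame. -/
noncomputable def cornerEquiv [StarRing A] (hE : E.IsFullLeft)
    (hP : IsStarProjection (F.mat 1)) : B ≃+* corner S hP :=
  RingEquiv.ofBijective
    ({ toFun := fun b => ⟨F.mat b, F.mat_one_mul b, F.mat_mul_one b⟩
       map_mul' := fun b c => Subtype.ext (F.mat_mul b c)
       map_zero' := Subtype.ext <| by
         have := F.mat_add 0 0
         simpa using this
       map_add' := fun b c => Subtype.ext (F.mat_add b c) } : B →ₙ+* corner S hP)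
    ⟨fun _ _ h => F.mat_injective hE (congrArg Subtype.val h),
      fun M => (F.exists_mat_eq hE M.1 M.2.1 M.2.2).imp fun _ h => Subtype.ext h⟩

theorem coe_cornerEquiv [StarRing A] (hE : E.IsFullLeft)
    (hP : IsStarProjection (F.mat 1)) (b : B) :
    (F.cornerEquiv hE hP b : Matrix (Fin n) (Fin n) A) = F.mat b := rfl

theorem cornerEquiv_smul [StarRing A] (hE : E.IsFullLeft)
    (hP : IsStarProjection (F.mat 1)) (c : S) (b : B) :
    F.cornerEquiv hE hP (c • b) = c • F.cornerEquiv hE hP b :=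
  Subtype.ext (F.mat_smul c b)

/-- A frame whose matrices represent `B` by a `*`-homomorphism. -/
def IsHermitian [StarRing A] [StarRing B] : Prop := ∀ b, star (F.mat b) = F.mat (star b)

end Frame

end Frames

/-! ### The conjugate bimodule. -/

section Conjugate

variable {S : Type w} [CommRing S] [StarRing S]
  {A B : Type u} [Ring A] [StarRing A] [Algebra S A] [StarModule S A]
  [Ring B] [StarRing B] [Algebra S B] [StarModule S B]

/-- The additive group of the conjugate bimodule. -/
def Bimod.ConjCarrier (E : Bimod S B A) : Type u := E.carrier

instance (E : Bimod S B A) : AddCommGroup E.ConjCarrier := E.addCommGroup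

/-- The identity from a bimodule to its conjugate. -/
def Bimod.toConj (E : Bimod S B A) : E ≃+ E.ConjCarrier := AddEquiv.refl _

/-- Scalars act through their conjugates so that x̄ ⊗ z ↦ ⟨x, z⟩ becomes linear in both factors. -/
instance (E : Bimod S B A) : Module S E.ConjCarrier :=
  { smul := fun c x => E.toConj (star c • E.toConj.symm x)
    one_smul := fun x => by
      change E.toConj (star (1 : S) • E.toConj.symm x) = x
      simp
    mul_smul := fun c d x => by
      change E.toConj (star (c * d) • E.toConj.symm x) =
        E.toConj (star c • E.toConj.symm (E.toConj (star d • E.toConj.symm x)))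
      rw [AddEquiv.symm_apply_apply, smul_smul, star_mul, mul_comm]
    smul_zero := fun c => by
      change E.toConj (star c • E.toConj.symm 0) = 0
      simp
    smul_add := fun c x y => by
      change E.toConj (star c • E.toConj.symm (x + y)) =
        E.toConj (star c • E.toConj.symm x) + E.toConj (star c • E.toConj.symm y)
      simp
    add_smul := fun c d x => by
      change E.toConj (star (c + d) • E.toConj.symm x) =
        E.toConj (star c • E.toConj.symm x) + E.toConj (star d • E.toConj.symm x)
      simp [add_smul]
    zero_smul := fun x => by
      change E.toConj (star (0 : S) • E.toConj.symm x) = 0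
      simp }

instance (E : Bimod S B A) : Module A E.ConjCarrier :=
  { smul := fun a x => E.toConj (E.toConj.symm x <• star a)
    one_smul := fun x => by
      change E.toConj (E.toConj.symm x <• star (1 : A)) = x
      simp
    mul_smul := fun a b x => by
      change E.toConj (E.toConj.symm x <• star (a * b)) =
        E.toConj (E.toConj.symm (E.toConj (E.toConj.symm x <• star b)) <• star a)
      rw [AddEquiv.symm_apply_apply, smul_smul, star_mul, MulOpposite.op_mul]
    smul_zero := fun a => by
      change E.toConj (E.toConj.symm 0 <• star a) = 0
      simp
    smul_add := fun a x y => by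
      change E.toConj (E.toConj.symm (x + y) <• star a) =
        E.toConj (E.toConj.symm x <• star a) + E.toConj (E.toConj.symm y <• star a)
      simp
    add_smul := fun a b x => by
      change E.toConj (E.toConj.symm x <• star (a + b)) =
        E.toConj (E.toConj.symm x <• star a) + E.toConj (E.toConj.symm x <• star b)
      simp [add_smul]
    zero_smul := fun x => by
      change E.toConj (E.toConj.symm x <• star (0 : A)) = 0
      simp }

instance (E : Bimod S B A) : Module Bᵐᵒᵖ E.ConjCarrier :=
  { smul := fun b x => E.toConj (star b.unop • E.toConj.symm x)
    one_smul := fun x => by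
      change E.toConj (star (1 : B) • E.toConj.symm x) = x
      simp
    mul_smul := fun a b x => by
      change E.toConj (star (b.unop * a.unop) • E.toConj.symm x) =
        E.toConj (star a.unop • E.toConj.symm (E.toConj (star b.unop • E.toConj.symm x)))
      rw [AddEquiv.symm_apply_apply, smul_smul, star_mul]
    smul_zero := fun b => by
      change E.toConj (star b.unop • E.toConj.symm 0) = 0
      simp
    smul_add := fun b x y => by
      change E.toConj (star b.unop • E.toConj.symm (x + y)) =
        E.toConj (star b.unop • E.toConj.symm x) + E.toConj (star b.unop • E.toConj.symm y)
      simp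
    add_smul := fun a b x => by
      change E.toConj (star (a.unop + b.unop) • E.toConj.symm x) =
        E.toConj (star a.unop • E.toConj.symm x) + E.toConj (star b.unop • E.toConj.symm x)
      simp [add_smul]
    zero_smul := fun x => by
      change E.toConj (star (0 : B) • E.toConj.symm x) = 0
      simp }

/-- The conjugate bimodule, with `a x̄` and `x̄ b` the conjugates of `x a*` and `b* x`. -/
def Bimod.conj (E : Bimod S B A) : Bimod S A B where
  carrier := E.ConjCarrier
  leftTower := ⟨fun c a x => by
    change E.toConj (E.toConj.symm x <• star (c • a)) =
      E.toConj (star c • E.toConj.symm (E.toConj (E.toConj.symm x <• star a)))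
    rw [AddEquiv.symm_apply_apply, star_smul, MulOpposite.op_smul, smul_assoc]⟩
  rightTower := ⟨fun c b x => by
    change E.toConj (star (c • b.unop) • E.toConj.symm x) =
      E.toConj (star c • E.toConj.symm (E.toConj (star b.unop • E.toConj.symm x)))
    rw [AddEquiv.symm_apply_apply, star_smul, smul_assoc]⟩
  actionsCommute := ⟨fun a b x => by
    change E.toConj (E.toConj.symm (E.toConj (star b.unop • E.toConj.symm x)) <• star a) =
      E.toConj (star b.unop • E.toConj.symm (E.toConj (E.toConj.symm x <• star a)))
    rw [AddEquiv.symm_apply_apply, AddEquiv.symm_apply_apply, ← smul_comm]⟩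

end Conjugate

/-! ### Rank one operators and strong invertibility. -/

section PreHilbert

variable {R : Type w} [CommRing R] [LinearOrder R] [IsStrictOrderedRing R]
  {A B : Type u}
  [Ring A] [StarRing A] [Algebra (Cx R) A]
  [Ring B] [StarRing B] [Algebra (Cx R) B]

namespace PreHilbertBimod

variable (E : PreHilbertBimod R B A)

theorem inner_action_left (x y : E) (a : A) : E.inner (x <• a) y = star a * E.inner x y := by
  rw [← E.star_inner, E.inner_right_action, star_mul, E.star_inner]

theorem inner_sum {ι : Type*} (s : Finset ι) (x : E) (y : ι → E) :
    E.inner x (∑ i ∈ s, y i) = ∑ i ∈ s, E.inner x (y i) :=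
  map_sum (AddMonoidHom.mk' (E.inner x) (E.inner_add x)) y s

theorem sum_inner {ι : Type*} (s : Finset ι) (x : ι → E) (y : E) :
    E.inner (∑ i ∈ s, x i) y = ∑ i ∈ s, E.inner (x i) y := by
  rw [← E.star_inner, inner_sum, star_sum]
  simp only [E.star_inner]

theorem inner_left_ext {x y : E} (h : ∀ z, E.inner z x = E.inner z y) : x = y := by
  rw [← sub_eq_zero]
  refine E.eq_zero_of_inner _ fun z => ?_
  have := E.inner_add z (x - y) y
  rw [sub_add_cancel, h] at this
  exact right_eq_add.1 this

end PreHilbertBimod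

/-- A surjective isometric bimodule pairing onto the regular bimodule realizes it as an internal
tensor product. -/
theorem internalTensorIso_of_pairing {F : PreHilbertBimod R A B} {E : PreHilbertBimod R B A}
    (α : F ⊗[Cx R] E →ₗ[Cx R] A) (hs : Function.Surjective α)
    (hl : ∀ (c : A) (y : F) (x : E), α ((c • y) ⊗ₜ[Cx R] x) = c * α (y ⊗ₜ[Cx R] x))
    (hr : ∀ (y : F) (x : E) (a : A), α (y ⊗ₜ[Cx R] (x <• a)) = α (y ⊗ₜ[Cx R] x) * a)
    (hi : ∀ (y₁ y₂ : F) (x₁ x₂ : E), star (α (y₁ ⊗ₜ[Cx R] x₁)) * α (y₂ ⊗ₜ[Cx R] x₂) =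
      E.inner x₁ (F.inner y₁ y₂ • x₂)) :
    InternalTensorIso F E (PreHilbertBimod.regular R A) := by
  have hin : ∀ (y : F) (x : E) t, tensorInner F E y x t = star (α (y ⊗ₜ x)) * α t := by
    intro y x t
    induction t using TensorProduct.induction_on with
    | zero => simp
    | add s t hs ht => rw [map_add, map_add, hs, ht, mul_add]
    | tmul y' x' => exact (hi y y' x x').symm
  -- The inner product of s and t is α(s)*α(t), and 1 is a value of α, so degenerate tensors are
  -- exactly those killed by α.
  have hker : degeneracy F E = LinearMap.ker α := by
    ext t
    simp only [degeneracy, Submodule.mem_iInf, LinearMap.mem_ker, hin]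
    refine ⟨fun h => ?_, fun h y x => by rw [h, mul_zero]⟩
    obtain ⟨s, hs⟩ := hs 1
    have h2 : ∀ s, star (α s) * α t = 0 := by
      intro s
      induction s using TensorProduct.induction_on with
      | zero => simp
      | add s t hs ht => rw [map_add, star_add, add_mul, hs, ht, add_zero]
      | tmul y x => exact h y x
    simpa [hs] using h2 s
  let φ : InternalTensor F E →ₗ[Cx R] A := (degeneracy F E).liftQ α hker.le
  have hφ : Function.Bijective φ := by
    constructor
    · rw [injective_iff_map_eq_zero]
      intro q hq
      obtain ⟨t, rfl⟩ := Submodule.mkQ_surjective _ q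
      rw [Submodule.mkQ_apply, Submodule.Quotient.mk_eq_zero, hker]
      exact hq
    · intro a
      obtain ⟨t, rfl⟩ := hs a
      exact ⟨(degeneracy F E).mkQ t, rfl⟩
  exact ⟨LinearEquiv.ofBijective φ hφ, hl, hr, hi⟩

/-- The rank one operators `z ↦ x ⟨y, z⟩` of a pre-Hilbert bimodule as elements of `B`, which acts
faithfully. -/
structure RankOne (E : PreHilbertBimod R B A) where
  op : E → E → B
  op_smul : ∀ x y z, op x y • z = x <• E.inner y z
  faithful : ∀ b : B, (∀ x : E, b • x = 0) → b = 0

namespace RankOne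

variable {E : PreHilbertBimod R B A} (K : RankOne E)

/-- Faithfulness reduces the calculus of rank one operators in `B` to evaluation on vectors. -/
theorem ext_smul (K : RankOne E) {b c : B} (h : ∀ x : E, b • x = c • x) : b = c := by
  rw [← sub_eq_zero]
  exact K.faithful _ fun x => by rw [sub_smul, h, sub_self]

theorem add_op (x x' y : E) : K.op (x + x') y = K.op x y + K.op x' y :=
  K.ext_smul fun z => by rw [add_smul, K.op_smul, K.op_smul, K.op_smul, smul_add]

theorem smul_op (b : B) (x y : E) : K.op (b • x) y = b * K.op x y :=
  K.ext_smul fun z => by rw [mul_smul, K.op_smul, K.op_smul, ← smul_comm]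

theorem scalar_op (c : Cx R) (x y : E) : K.op (c • x) y = c • K.op x y :=
  K.ext_smul fun z => by rw [smul_assoc, K.op_smul, K.op_smul, smul_comm]

theorem action_op (x y : E) (a : A) : K.op (x <• a) y = K.op x (y <• star a) :=
  K.ext_smul fun z => by
    rw [K.op_smul, K.op_smul, E.inner_action_left, star_star, MulOpposite.op_mul, mul_smul]

theorem star_op (x y : E) : star (K.op x y) = K.op y x :=
  K.ext_smul fun z => E.inner_left_ext fun t => by
    rw [K.op_smul, E.inner_right_action, ← E.compatible, K.op_smul, E.inner_action_left,
      E.star_inner]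

theorem op_add (x y y' : E) : K.op x (y + y') = K.op x y + K.op x y' := by
  rw [← K.star_op, K.add_op, star_add, K.star_op, K.star_op]

theorem op_smul_right (b : B) (x y : E) : K.op x (b • y) = K.op x y * star b := by
  rw [← K.star_op, K.smul_op, star_mul, K.star_op]

theorem op_scalar [StarModule (Cx R) B] (c : Cx R) (x y : E) :
    K.op x (c • y) = star c • K.op x y := by
  rw [← K.star_op, K.scalar_op, star_smul, K.star_op]

theorem op_mul_op (x y x' y' : E) : K.op x y * K.op x' y' = K.op (x <• E.inner y x') y' := by
  rw [← K.smul_op, K.op_smul]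

theorem op_sum {ι : Type*} (s : Finset ι) (x : ι → E) (y : E) :
    K.op (∑ i ∈ s, x i) y = ∑ i ∈ s, K.op (x i) y :=
  map_sum (AddMonoidHom.mk' (fun x => K.op x y) fun x x' => K.add_op x x' y) x s

/-- The conjugate pre-Hilbert bimodule, with inner product `⟨x̄, ȳ⟩ = x ⟨y, ·⟩`. -/
def conj [StarModule (Cx R) A] [StarModule (Cx R) B]
    (hf : ∃ (m : ℕ) (y : Fin m → E), ∑ l, E.inner (y l) (y l) = 1) : PreHilbertBimod R A B where
  toBimod := E.toBimod.conj
  inner x y := K.op (E.toConj.symm x) (E.toConj.symm y)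
  inner_add x y z := by
    rw [← K.op_add]
    exact congrArg _ (map_add E.toConj.symm y z)
  inner_smul c x y := by
    change K.op _ (star c • _) = _
    rw [K.op_scalar, star_star]
  star_inner x y := K.star_op _ _
  inner_right_action x y b := by
    change K.op _ (star b • _) = _
    rw [K.op_smul_right, star_star]
  compatible a x y := by
    change K.op (_ <• star a) _ = K.op _ (_ <• star (star a))
    rw [K.action_op]
  nondegenerate x h := by
    obtain ⟨m, y, hy⟩ := hf
    have h1 : ∀ z w : E, E.toConj.symm x <• E.inner z w = 0 := fun z w => by
      rw [← K.op_smul, ← E.toConj.symm_apply_apply z]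
      exact (congrArg (· • w) (h (E.toConj z))).trans (zero_smul _ _)
    apply E.toConj.symm.injective
    change E.toConj.symm x = E.toConj.symm 0
    rw [map_zero, ← one_smul Aᵐᵒᵖ (E.toConj.symm x), ← MulOpposite.op_one, ← hy]
    rw [Finset.op_sum, Finset.sum_smul]
    exact Finset.sum_eq_zero fun l _ => h1 _ _
  completelyPositive n x := by
    obtain ⟨m, y, hy⟩ := hf
    -- Inserting 1 = ∑ ⟨yₗ, yₗ⟩ between u and v factors the operator and exhibits the matrix as a
    -- sum of Gram matrices over `B`. Here 1 has to be a sum of squares, not merely of inner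
    -- products.
    have h1 : ∀ u v : E, K.op u v = ∑ l, star (K.op (y l) u) * K.op (y l) v := fun u v => by
      simp only [K.star_op, K.op_mul_op]
      rw [← K.op_sum, ← Finset.sum_smul, ← Finset.op_sum, hy, MulOpposite.op_one, one_smul]
    have := isPositive_gram (R := R) Finset.univ
      fun (l : Fin m) (j : Fin n) => K.op (y l) (E.toConj.symm (x j))
    simp only [← h1] at this
    exact this

/-- A pre-Hilbert bimodule with rank one operators in `B` is invertible when `1` is a sum of
rank one operators and `1 = ∑ ⟨yₗ, yₗ⟩`. -/
theorem isInvertible [StarModule (Cx R) A] [StarModule (Cx R) B]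
    (hf : ∃ (m : ℕ) (y : Fin m → E), ∑ l, E.inner (y l) (y l) = 1)
    (hu : ∃ (n : ℕ) (u v : Fin n → E), ∑ k, K.op (u k) (v k) = 1) : E.IsInvertible := by
  refine ⟨K.conj hf, ?_, ?_⟩
  -- The `A`-valued inner product pairs the conjugate with `E`; the rank one operators pair `E` with
  -- the conjugate. Each is onto because it reaches 1.
  · let α : E.toBimod.conj ⊗[Cx R] E →ₗ[Cx R] A := TensorProduct.lift <| LinearMap.mk₂ (Cx R)
      (fun (x : E.toBimod.conj) (z : E) => E.inner (E.toConj.symm x) z)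
      (fun x y z => by
        rw [← E.inner_add_left]
        exact congrArg (E.inner · z) (map_add E.toConj.symm x y))
      (fun c x z => by
        change E.inner (star c • _) z = _
        rw [← E.star_inner, E.inner_smul, star_smul, star_star, E.star_inner])
      (fun x y z => E.inner_add _ _ _) (fun c x z => E.inner_smul _ _ _)
    have hα : ∀ (x z : E), α (E.toConj x ⊗ₜ z) = E.inner x z := fun x z => rfl
    have hs : Function.Surjective α := fun a => by
      obtain ⟨m, y, hy⟩ := hf
      refine ⟨∑ l, E.toConj (y l) ⊗ₜ (y l <• a), ?_⟩
      rw [map_sum]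
      simp only [hα, E.inner_right_action]
      rw [← Finset.sum_mul, hy, one_mul]
    refine internalTensorIso_of_pairing (F := K.conj hf) α hs (fun a x z => ?_)
      (fun x z a => ?_) (fun y₁ y₂ x₁ x₂ => ?_)
    · change E.inner (_ <• star a) _ = a * E.inner _ _
      rw [E.inner_action_left, star_star]
    · exact E.inner_right_action _ _ _
    · change star (E.inner (E.toConj.symm y₁) x₁) * E.inner (E.toConj.symm y₂) x₂ =
        E.inner x₁ (K.op (E.toConj.symm y₁) (E.toConj.symm y₂) • x₂)
      rw [K.op_smul, E.inner_right_action, E.star_inner]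
  · let β : E ⊗[Cx R] E.toBimod.conj →ₗ[Cx R] B := TensorProduct.lift <| LinearMap.mk₂ (Cx R)
      (fun (x : E) (y : E.toBimod.conj) => K.op x (E.toConj.symm y))
      (fun x x' y => K.add_op _ _ _) (fun c x y => K.scalar_op _ _ _)
      (fun x y y' => by
        rw [← K.op_add]
        exact congrArg _ (map_add E.toConj.symm y y'))
      (fun c x y => by
        change K.op _ (star c • _) = _
        rw [K.op_scalar, star_star])
    have hβ : ∀ (x y : E), β (x ⊗ₜ E.toConj y) = K.op x y := fun x z => rfl
    have hs : Function.Surjective β := fun b => by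
      obtain ⟨n, u, v, huv⟩ := hu
      refine ⟨∑ k, (b • u k) ⊗ₜ E.toConj (v k), ?_⟩
      rw [map_sum]
      simp only [hβ, K.smul_op]
      rw [← Finset.mul_sum, huv, mul_one]
    refine internalTensorIso_of_pairing (E := K.conj hf) β hs (fun b x y => ?_)
      (fun x y b => ?_) (fun x₁ x₂ y₁ y₂ => ?_)
    · exact K.smul_op _ _ _
    · change K.op _ (star b • _) = K.op _ _ * b
      rw [K.op_smul_right, star_star]
    · change star (K.op x₁ (E.toConj.symm y₁)) * K.op x₂ (E.toConj.symm y₂) =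
        K.op (E.toConj.symm y₁) (E.toConj.symm y₂ <• star (E.inner x₁ x₂))
      rw [K.star_op, K.op_mul_op, K.action_op]

end RankOne

end PreHilbert

/-! ### From hermitian frames to strong equivalence bimodules. -/

section HermitianFrames

variable {R : Type w} [CommRing R] [LinearOrder R] [IsStrictOrderedRing R]
  {A B : Type u}
  [Ring A] [StarRing A] [Algebra (Cx R) A]
  [Ring B] [StarRing B] [Algebra (Cx R) B]

theorem star_mulVec_dotProduct {n : ℕ} (M : Matrix (Fin n) (Fin n) A) (v v' : Fin n → A) :
    star (M.mulVec v) ⬝ᵥ v' = star v ⬝ᵥ (star M).mulVec v' := by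
  rw [Matrix.star_mulVec, Matrix.dotProduct_mulVec]
  rfl

theorem star_star_dotProduct {n : ℕ} (v v' : Fin n → A) :
    star (star v ⬝ᵥ v') = star v' ⬝ᵥ v := by
  simp [dotProduct, star_sum]

/-- The rank one operators of a pre-Hilbert bimodule over all right linear endomorphisms. -/
noncomputable def PreHilbertBimod.rankOne (E : PreHilbertBimod R B A) (h : E.toBimod.IsFullLeft) :
    RankOne E :=
  have hT : ∀ x y : E, ∃ b : B, ∀ z, x <• E.inner y z = b • z := fun x y => h.exists_smul
    { toFun := fun z => x <• E.inner y z
      map_add' := fun z z' => by rw [E.inner_add, MulOpposite.op_add, add_smul]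
      map_smul' := fun a z => by
        obtain ⟨a, rfl⟩ := MulOpposite.op_surjective a
        rw [E.inner_right_action, MulOpposite.op_mul, mul_smul, RingHom.id_apply] }
  { op := fun x y => (hT x y).choose
    op_smul := fun x y z => ((hT x y).choose_spec z).symm
    faithful := h.faithful }

namespace Frame

variable {E : Bimod (Cx R) B A} {n : ℕ} (F : Frame E n)

/-- The inner product `∑ fᵢ(x)* fᵢ(y)` of a hermitian frame. -/
def preHilbert (hF : F.IsHermitian) : PreHilbertBimod R B A where
  toBimod := E
  inner x y := star (F.col x) ⬝ᵥ F.col y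
  inner_add x y z := by rw [col_add, dotProduct_add]
  inner_smul c x y := by rw [col_smul_scalar, dotProduct_smul]
  star_inner x y := star_star_dotProduct _ _
  inner_right_action x y a := by
    simp only [dotProduct, col_action, Finset.sum_mul, mul_assoc]
  compatible b x y := by rw [col_smul, star_mulVec_dotProduct, hF, ← col_smul]
  nondegenerate x h := by
    -- As the idempotent is self-adjoint, pairing x with the frame vectors reads off the adjoints of
    -- its coordinates.
    have h0 : F.col x = 0 := by
      ext i
      have := h (F.comb (Pi.single i 1))
      rw [col_comb, ← star_one B, ← hF, ← star_mulVec_dotProduct, mat_one_col,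
        dotProduct_single_one] at this
      simpa using this
    rw [← F.comb_col x, h0]
    simp [comb]
  completelyPositive m x := isPositive_gram Finset.univ fun k i => F.col (x i) k

end Frame

/-- A frame with self-adjoint idempotent whose coordinates compute the inner product. -/
structure Frame.IsOrthonormal {E : PreHilbertBimod R B A} {n : ℕ} (F : Frame E.toBimod n) :
    Prop where
  star_mat_one : star (F.mat 1) = F.mat 1
  inner_eq : ∀ x y : E, E.inner x y = star (F.col x) ⬝ᵥ F.col y

theorem Frame.IsHermitian.isOrthonormal {E : Bimod (Cx R) B A} {n : ℕ} {F : Frame E n}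
    (hF : F.IsHermitian) : Frame.IsOrthonormal (E := F.preHilbert hF) F :=
  ⟨(hF 1).trans (by rw [star_one]; rfl), fun _ _ => rfl⟩

namespace Frame.IsOrthonormal

variable {E : PreHilbertBimod R B A} {n : ℕ} {F : Frame E.toBimod n}

/-- The idempotent produced by `col_comb` moves to the other side, being self-adjoint, and fixes
`col x`. -/
theorem inner_comb (hF : F.IsOrthonormal) (x : E) (v : Fin n → A) : E.inner x (F.comb v) = star (F.col x) ⬝ᵥ v := by
  rw [hF.inner_eq, col_comb, ← hF.star_mat_one, ← star_mulVec_dotProduct, mat_one_col]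

theorem comb_inner (hF : F.IsOrthonormal) (x : E) (v : Fin n → A) : E.inner (F.comb v) x = star v ⬝ᵥ F.col x := by
  rw [← E.star_inner, hF.inner_comb, star_star_dotProduct]

/-- Reconstruction thus reads x = ∑ eᵢ⟨eᵢ, x⟩, so 1 ∈ `B` is a sum of rank one operators. -/
theorem vec_inner (hF : F.IsOrthonormal) (x : E) (i : Fin n) : E.inner (F.vec i) x = F.col x i := by
  rw [← comb_single, hF.comb_inner, ← Pi.single_star, star_one, single_one_dotProduct]

/-- The right linear functionals are represented by vectors. -/
theorem exists_inner_eq (hF : F.IsOrthonormal) (g : E →ₗ[Aᵐᵒᵖ] A) : ∃ u : E, ∀ x, E.inner u x = g x := by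
  refine ⟨F.comb fun i => star (g (F.vec i)), fun x => ?_⟩
  rw [hF.comb_inner]
  conv_rhs => rw [← F.comb_col x, comb, map_sum]
  refine Finset.sum_congr rfl fun i _ => ?_
  rw [map_smul, Pi.star_apply, star_star]
  rfl

/-- Under (I) and (II⁻), `1` is a sum of squares of vectors if `E` is a generator. -/
theorem exists_sum_inner_self (hF : F.IsOrthonormal) (hI : CondI A) (hII : CondIIMinus R A) (hE : E.toBimod.IsGenerator) :
    ∃ (m : ℕ) (y : Fin m → E), ∑ l, E.inner (y l) (y l) = 1 := by
  obtain ⟨m, g, x, hg⟩ := hE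
  choose u hu using hF.exists_inner_eq
  -- The generator relation ∑ gₖ(xₖ) = 1, with gₖ represented by a vector, is a relation S*T = 1
  -- between columns indexed by pairs (vector, coordinate).
  have h1 : ∑ p : Fin m × Fin n, star (F.col (u (g p.1)) p.2) * F.col (x p.1) p.2 = 1 := by
    rw [Fintype.sum_prod_type, ← hg]
    exact Finset.sum_congr rfl fun k _ => (hF.inner_eq _ _).symm.trans (hu (g k) (x k))
  have h2 := hI.isUnit_sum _ _ h1
  have hpos := isPositive_gram (R := R) (n := 1) Finset.univ
    fun (p : Fin m × Fin n) (_ : Fin 1) => F.col (x p.1) p.2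
  have h3 : ∑ p : Fin m × Fin n, star (F.col (x p.1) p.2) * F.col (x p.1) p.2 =
      ∑ k, E.inner (x k) (x k) := by
    rw [Fintype.sum_prod_type]
    exact Finset.sum_congr rfl fun k _ => (hF.inner_eq (x k) (x k)).symm
  rw [h3] at h2
  simp only [h3] at hpos
  -- Only the factorization H = U*U of a 1×1 matrix is wanted; P = 0 makes the commutation clause
  -- empty.
  obtain ⟨U, ⟨U, rfl⟩, hUU, -⟩ := hII 1 _ 0 hpos (by
    convert h2.map (Matrix.scalar (Fin 1))
    ext i j
    rw [Subsingleton.elim i j, Matrix.scalar_apply, Matrix.diagonal_apply_eq, Matrix.of_apply])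
    (.zero _) (Commute.zero_left _)
  have hUU' : ∑ k, E.inner (x k) (x k) =
      star ((U : Matrix (Fin 1) (Fin 1) A) 0 0) * (U : Matrix (Fin 1) (Fin 1) A) 0 0 := by
    have := congrFun (congrFun hUU 0) 0
    simpa [Matrix.mul_apply, Matrix.star_apply] using this
  have hc : (U : Matrix (Fin 1) (Fin 1) A) 0 0 * (↑U⁻¹ : Matrix (Fin 1) (Fin 1) A) 0 0 = 1 := by
    have := congrFun (congrFun U.mul_inv 0) 0
    simpa [Matrix.mul_apply] using this
  generalize (↑U⁻¹ : Matrix (Fin 1) (Fin 1) A) 0 0 = d at hc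
  -- With u the entry of `U` and ud = 1, rescaling by d turns ∑ ⟨xₖ, xₖ⟩ = u*u into d*u*ud = 1.
  refine ⟨m, fun k => x k <• d, ?_⟩
  have h4 : ∀ k, E.inner (x k <• d) (x k <• d) = star d * E.inner (x k) (x k) * d := fun k => by
    rw [E.inner_action_left, E.inner_right_action, mul_assoc]
  refine (Finset.sum_congr rfl fun k _ => h4 k).trans ?_
  rw [← Finset.sum_mul, ← Finset.mul_sum, hUU', ← mul_assoc, ← star_mul, hc, star_one, one_mul, hc]

/-- An equivalence bimodule with an orthonormal frame is a strong equivalence bimodule. -/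
theorem isInvertible [StarModule (Cx R) A] [StarModule (Cx R) B] (hF : F.IsOrthonormal)
    (hI : CondI A) (hII : CondIIMinus R A) (hE : E.toBimod.IsInvertible) : E.IsInvertible := by
  obtain ⟨-, hfull, hgen⟩ := hE.morita
  let K := E.rankOne hfull
  refine K.isInvertible (hF.exists_sum_inner_self hI hII hgen) ⟨n, F.vec, F.vec, ?_⟩
  refine K.ext_smul fun x => ?_
  rw [Finset.sum_smul, one_smul]
  simp only [K.op_smul, hF.vec_inner]
  exact F.comb_col x

end Frame.IsOrthonormal

end HermitianFrames

/-! ### Orthonormal frames of strong equivalence bimodules. -/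

section StrongFrames

variable {R : Type w} [CommRing R] [LinearOrder R] [IsStrictOrderedRing R]
  {A B : Type u}
  [Ring A] [StarRing A] [Algebra (Cx R) A]
  [Ring B] [StarRing B] [Algebra (Cx R) B]

/-- An invertible pre-Hilbert bimodule has a reconstruction formula `x = ∑ uₖ ⟨vₖ, x⟩`. -/
theorem PreHilbertBimod.IsInvertible.exists_sum_inner {E : PreHilbertBimod R B A}
    (h : E.IsInvertible) :
    ∃ (ι : Type) (_ : Fintype ι) (u v : ι → E), ∀ x, ∑ k, u k <• E.inner (v k) x = x := by
  obtain ⟨F, h1, h2⟩ := h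
  obtain ⟨α, hα⟩ := InternalTensorIso.exists_pairing h1
  obtain ⟨β, hβ⟩ := InternalTensorIso.exists_pairing h2
  obtain ⟨t, ht⟩ := hα.surj 1
  obtain ⟨n, y, x, rfl⟩ := exists_sum_tmul t
  obtain ⟨s, hs⟩ := hβ.surj 1
  obtain ⟨m, x', w, rfl⟩ := exists_sum_tmul s
  rw [map_sum] at ht hs
  -- This vector represents α(y', ·): multiply α(y' ⊗ x') on the left by 1* = ∑ α(yⱼ ⊗ xⱼ)* and use
  -- isometry. Consequently ⟨y₁, y₂⟩ ∈ `B` acts on `E` as the rank one operator of z(y₁) and z(y₂).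
  let z : F → E := fun y' => ∑ j, F.inner y' (y j) • x j
  have hz : ∀ y' x', α (y' ⊗ₜ x') = E.inner (z y') x' := by
    intro y' x'
    rw [← one_mul (α _), ← star_one, ← ht, star_sum, Finset.sum_mul, E.sum_inner]
    refine Finset.sum_congr rfl fun j _ => ?_
    rw [hα.inner, E.compatible, F.star_inner]
  have hF : ∀ y₁ y₂ x₂, F.inner y₁ y₂ • x₂ = z y₁ <• E.inner (z y₂) x₂ := by
    intro y₁ y₂ x₂
    refine E.inner_left_ext fun x₁ => ?_
    rw [← hα.inner, E.inner_right_action, hz, hz, E.star_inner]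
  refine ⟨Fin m × Fin m, inferInstance, fun p => z (w p.1),
    fun p => z (E.inner (x' p.1) (x' p.2) • w p.2), fun a => ?_⟩
  simp only [← hF]
  rw [← Finset.sum_smul, Fintype.sum_prod_type]
  -- Expand 1 = 1* · 1 with 1 = ∑ β(x'ⱼ ⊗ wⱼ).
  have h3 : ∑ j, ∑ k, F.inner (w j) (E.inner (x' j) (x' k) • w k) = 1 := by
    simp only [← hβ.inner]
    simp only [← Finset.mul_sum, ← star_sum, hs, star_one, mul_one]
  exact (congrArg (· • a) h3).trans (one_smul _ a)

/-- In a frame with self-adjoint idempotent, the inner product of an invertible pre-Hilbert bimodule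
is the standard one up to an invertible matrix of the corner. -/
theorem Frame.exists_inner_eq_mulVec {E : PreHilbertBimod R B A} (hE : E.IsInvertible)
    (hII : CondIIMinus R A) {n : ℕ} (F : Frame E.toBimod n) (hP : IsStarProjection (F.mat 1)) :
    ∃ V W : Matrix (Fin n) (Fin n) A, F.mat 1 * V = V ∧ V * F.mat 1 = V ∧ F.mat 1 * W = W ∧
      W * F.mat 1 = W ∧ V * W = F.mat 1 ∧ W * V = F.mat 1 ∧
      ∀ x y : E, E.inner x y = star (V.mulVec (F.col x)) ⬝ᵥ V.mulVec (F.col y) := by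
  obtain ⟨ι, _, u, v, huv⟩ := hE.exists_sum_inner
  set P := F.mat 1 with hPdef
  have hPP : P * P = P := hP.isIdempotentElem
  have hPs : star P = P := hP.isSelfAdjoint
  let H : Matrix (Fin n) (Fin n) A := Matrix.of fun i j => E.inner (F.vec i) (F.vec j)
  have hHs : star H = H := by
    ext i j
    exact E.star_inner _ _
  have hH : ∀ x y : E, E.inner x y = star (F.col x) ⬝ᵥ H.mulVec (F.col y) := by
    intro x y
    conv_lhs => rw [← F.comb_col x, ← F.comb_col y]
    simp only [Frame.comb, E.sum_inner, E.inner_sum, E.inner_action_left, E.inner_right_action,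
      dotProduct, Matrix.mulVec, Pi.star_apply, ← Finset.mul_sum]
    rfl
  have hHP : H * P = H := by
    ext i j
    have : F.vec j = ∑ k, F.vec k <• F.coord k (F.vec j) := (F.sum_vec _).symm
    change _ = E.inner (F.vec i) (F.vec j)
    rw [this, E.inner_sum, Matrix.mul_apply]
    refine Finset.sum_congr rfl fun k _ => ?_
    rw [E.inner_right_action, hPdef, Frame.mat, Matrix.of_apply, one_smul]
    rfl
  have hPH : P * H = H := by
    have := congrArg star hHP
    rwa [star_mul, hHs, hPs] at this
  -- The coordinate matrix of ∑ uₘ vₘ*. The reconstruction formula says that it inverts the Gram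
  -- matrix H from the left, relative to P.
  let K : Matrix (Fin n) (Fin n) A :=
    Matrix.of fun i k => ∑ m, F.col (u m) i * (star (F.col (v m)) k)
  have hKH : K * H = P := by
    ext i j
    have h1 : ∀ m, E.inner (v m) (F.vec j) = ∑ k, star (F.col (v m) k) * H k j := fun m => by
      conv_lhs => rw [← F.comb_col (v m)]
      simp only [Frame.comb, E.sum_inner, E.inner_action_left]
      rfl
    have h2 : P i j = ∑ m, F.col (u m) i * E.inner (v m) (F.vec j) := by
      rw [hPdef, Frame.mat, Matrix.of_apply, one_smul]
      conv_lhs => rw [← huv (F.vec j), map_sum]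
      exact Finset.sum_congr rfl fun m _ => F.col_action _ _ _
    rw [h2, Matrix.mul_apply]
    simp only [h1, K, Matrix.of_apply, Finset.mul_sum, Finset.sum_mul, mul_assoc]
    exact Finset.sum_comm
  -- the inverse of `H` in the corner
  let L := P * K * P
  have hLH : L * H = P := by
    change P * K * P * H = P
    rw [mul_assoc, hPH, mul_assoc, hKH, hPP]
  have hLs : star L = L := by
    have h1 : H * star L = P := by rw [← hHs, ← star_mul, hLH, hPs]
    calc star L = P * star L := by
          simp only [L, star_mul, hPs, ← mul_assoc, hPP]
      _ = L * (H * star L) := by rw [← hLH, mul_assoc]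
      _ = L := by rw [h1]; simp only [L, mul_assoc, hPP]
  have hHL : H * L = P := by rw [← hHs, ← hLs, ← star_mul, hLH, hPs]
  have hLP : L * P = L := by simp only [L, mul_assoc, hPP]
  have hPL : P * L = L := by simp only [L, ← mul_assoc, hPP]
  -- H is invertible only in the corner. Adding 1 - P makes it invertible in the full matrix algebra
  -- while keeping it positive and commuting with P, so (II⁻) applies with this P. The factor U then
  -- commutes with P, and V = PU lies in the corner with V*V = H.
  have hunit : IsUnit (H + (1 - P)) := by
    refine isUnit_iff_exists.2 ⟨L + (1 - P), ?_, ?_⟩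
    · simp only [add_mul, mul_add, sub_mul, mul_sub, one_mul, mul_one, hHL, hHP, hPL, hPP]
      abel
    · simp only [add_mul, mul_add, sub_mul, mul_sub, one_mul, mul_one, hLH, hLP, hPH, hPP]
      abel
  have hpos : IsPositive R (H + (1 - P)) := by
    refine (E.completelyPositive n F.vec).add ?_
    have h1 : 1 - P = star (1 - P) * (1 - P) := by
      rw [star_sub, star_one, hPs, mul_sub, sub_mul, sub_mul, hPP]
      simp
    rw [h1]
    exact isPositive_star_mul_self _
  have hcomm : Commute P (H + (1 - P)) := by
    change P * (H + (1 - P)) = (H + (1 - P)) * P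
    rw [mul_add, add_mul, hPH, hHP, mul_sub, sub_mul, one_mul, mul_one]
  obtain ⟨U, ⟨U, rfl⟩, hU, hPU⟩ := hII n _ P hpos hunit hP hcomm
  have hPU' : Commute P ↑U⁻¹ := hPU.units_inv_right
  have hVV : star (P * (U : Matrix (Fin n) (Fin n) A)) * (P * U) = H := by
    calc star (P * (U : Matrix (Fin n) (Fin n) A)) * (P * U)
        = star (U : Matrix (Fin n) (Fin n) A) * (P * P * U) := by
          rw [star_mul, hPs]; simp only [mul_assoc]
      _ = (H + (1 - P)) * P := by rw [hPP, hPU.eq, ← mul_assoc, ← hU]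
      _ = H := by rw [add_mul, hHP, sub_mul, one_mul, hPP, sub_self, add_zero]
  refine ⟨P * (U : Matrix (Fin n) (Fin n) A), P * (↑U⁻¹ : Matrix (Fin n) (Fin n) A), ?_, ?_, ?_, ?_, ?_, ?_, fun x y => ?_⟩
  · rw [← mul_assoc, hPP]
  · rw [mul_assoc, ← hPU.eq, ← mul_assoc, hPP]
  · rw [← mul_assoc, hPP]
  · rw [mul_assoc, ← hPU'.eq, ← mul_assoc, hPP]
  · rw [hPU.eq, mul_assoc, ← mul_assoc P, hPP, hPU'.eq, ← mul_assoc, U.mul_inv, one_mul]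
  · rw [hPU'.eq, mul_assoc, ← mul_assoc P, hPP, hPU.eq, ← mul_assoc, U.inv_mul, one_mul]
  · rw [star_mulVec_dotProduct, Matrix.mulVec_mulVec, hVV, hH]

/-- Under (I) and (II⁻), an invertible pre-Hilbert bimodule has an orthonormal frame. -/
theorem PreHilbertBimod.IsInvertible.exists_isOrthonormal {E : PreHilbertBimod R B A}
    (hE : E.IsInvertible) (hI : CondI A) (hII : CondIIMinus R A) :
    ∃ (n : ℕ) (F : Frame E.toBimod n), F.IsOrthonormal := by
  obtain ⟨⟨n, ⟨F₀⟩⟩, -, -⟩ := hE.toBimod.morita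
  obtain ⟨F, hP⟩ := F₀.exists_isStarProjection hI
  obtain ⟨V, W, -, hVP, -, -, hVW, hWV, h⟩ := F.exists_inner_eq_mulVec hE hII hP
  -- The coordinates become Vf, which makes the inner product standard, and the idempotent VPW = VW
  -- is still P.
  refine ⟨n, F.change V W (by rw [hWV]; exact hP.isIdempotentElem), ?_, h⟩
  rw [F.change_mat, hVP, hVW]
  exact hP.isSelfAdjoint

end StrongFrames

/-! ### Twisting a bimodule by an automorphism of `B`. -/

section Twist

variable {S : Type w} [CommRing S]
  {A B : Type u} [Ring A] [Algebra S A] [Ring B] [Algebra S B]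

/-- The additive group of a twisted bimodule. -/
def Bimod.TwistCarrier (E : Bimod S B A) (_ : B ≃ₐ[S] B) : Type u := E.carrier

instance (E : Bimod S B A) (Φ : B ≃ₐ[S] B) : AddCommGroup (E.TwistCarrier Φ) := E.addCommGroup

instance (E : Bimod S B A) (Φ : B ≃ₐ[S] B) : Module S (E.TwistCarrier Φ) := E.module

instance (E : Bimod S B A) (Φ : B ≃ₐ[S] B) : Module Aᵐᵒᵖ (E.TwistCarrier Φ) := E.rightModule

instance (E : Bimod S B A) (Φ : B ≃ₐ[S] B) : Module B (E.TwistCarrier Φ) :=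
  Module.compHom E.carrier (Φ : B →+* B)

/-- The bimodule `E` with `b` acting from the left as `Φ b`. -/
def Bimod.twist (E : Bimod S B A) (Φ : B ≃ₐ[S] B) : Bimod S B A where
  carrier := E.TwistCarrier Φ
  rightTower := E.rightTower
  leftTower := ⟨fun c b x => by
    change (HSMul.hSMul (β := E.carrier) (γ := E.carrier) (Φ (c • b)) x) =
      c • (HSMul.hSMul (β := E.carrier) (γ := E.carrier) (Φ b) x)
    rw [map_smul]
    exact E.leftTower.smul_assoc c (Φ b) x⟩
  actionsCommute := ⟨fun b a x => E.actionsCommute.smul_comm (Φ b) a x⟩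

/-- The additive group of a bimodule twisted on the right. -/
def Bimod.TwistRightCarrier (F : Bimod S A B) (_ : B ≃ₐ[S] B) : Type u := F.carrier

instance (F : Bimod S A B) (Φ : B ≃ₐ[S] B) : AddCommGroup (F.TwistRightCarrier Φ) := F.addCommGroup

instance (F : Bimod S A B) (Φ : B ≃ₐ[S] B) : Module S (F.TwistRightCarrier Φ) := F.module

instance (F : Bimod S A B) (Φ : B ≃ₐ[S] B) : Module A (F.TwistRightCarrier Φ) := F.leftModule

instance (F : Bimod S A B) (Φ : B ≃ₐ[S] B) : Module Bᵐᵒᵖ (F.TwistRightCarrier Φ) :=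
  Module.compHom F.carrier (RingHom.op (Φ : B →+* B))

/-- The bimodule `F` with `b` acting from the right as `Φ b`. -/
def Bimod.twistRight (F : Bimod S A B) (Φ : B ≃ₐ[S] B) : Bimod S A B where
  carrier := F.TwistRightCarrier Φ
  leftTower := F.leftTower
  rightTower := ⟨fun c b x => by
    change (HSMul.hSMul (β := F.carrier) (γ := F.carrier) (MulOpposite.op (Φ (c • b.unop))) x) =
      c • (HSMul.hSMul (β := F.carrier) (γ := F.carrier) (MulOpposite.op (Φ b.unop)) x)
    rw [map_smul, MulOpposite.op_smul]
    exact F.rightTower.smul_assoc c (MulOpposite.op (Φ b.unop)) x⟩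
  actionsCommute := ⟨fun a b x => F.actionsCommute.smul_comm a (MulOpposite.op (Φ b.unop)) x⟩

/-- The identity from a twisted bimodule to the bimodule. -/
def Bimod.untwist (E : Bimod S B A) (Φ : B ≃ₐ[S] B) : E.twist Φ ≃ₗ[S] E := LinearEquiv.refl S E

theorem Bimod.untwist_smul (E : Bimod S B A) (Φ : B ≃ₐ[S] B) (b : B) (x : E.twist Φ) :
    E.untwist Φ (b • x) = Φ b • E.untwist Φ x := rfl

/-- The identity from a bimodule twisted on the right to the bimodule. -/
def Bimod.untwistRight (F : Bimod S A B) (Φ : B ≃ₐ[S] B) : F.twistRight Φ ≃ₗ[S] F :=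
  LinearEquiv.refl S F

theorem Bimod.untwistRight_smul (F : Bimod S A B) (Φ : B ≃ₐ[S] B) (x : F.twistRight Φ) (b : B) :
    F.untwistRight Φ (x <• b) = F.untwistRight Φ x <• Φ b := rfl

/-- Reparametrizing the middle algebra by a surjection only relabels the relations. The cases needed
are σ = Φ, for twists meeting in the middle, and σ = `id`, for twists on the outside. -/
theorem map_balancing {C D : Type u} [Ring C] [Algebra S C] [Ring D] [Algebra S D]
    {F F' : Bimod S C B} {E E' : Bimod S B D} (f : F' ≃ₗ[S] F) (e : E' ≃ₗ[S] E) (σ : B → B)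
    (hσ : Function.Surjective σ) (hf : ∀ y (b : B), f (y <• b) = f y <• σ b)
    (he : ∀ (b : B) x, e (b • x) = σ b • e x) :
    (balancing F' E').map (TensorProduct.congr f e).toLinearMap = balancing F E := by
  rw [balancing, balancing, Submodule.map_span]
  congr 1
  ext t
  constructor
  · rintro ⟨_, ⟨y, b, x, rfl⟩, rfl⟩
    exact ⟨f y, σ b, e x, by simp [hf, he]⟩
  · rintro ⟨y, b, x, rfl⟩
    obtain ⟨b, rfl⟩ := hσ b
    exact ⟨_, ⟨f.symm y, b, e.symm x, rfl⟩, by simp [hf, he]⟩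

theorem exists_balancedTensor_equiv {C D : Type u} [Ring C] [Algebra S C] [Ring D] [Algebra S D]
    {F F' : Bimod S C B} {E E' : Bimod S B D} (f : F' ≃ₗ[S] F) (e : E' ≃ₗ[S] E) (σ : B → B)
    (hσ : Function.Surjective σ) (hf : ∀ y (b : B), f (y <• b) = f y <• σ b)
    (he : ∀ (b : B) x, e (b • x) = σ b • e x) :
    ∃ p : BalancedTensor F' E' ≃ₗ[S] BalancedTensor F E, ∀ y x,
      p ((balancing F' E').mkQ (y ⊗ₜ x)) = (balancing F E).mkQ (f y ⊗ₜ e x) :=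
  ⟨Submodule.Quotient.equiv _ _ (TensorProduct.congr f e) (map_balancing f e σ hσ hf he),
    fun _ _ => rfl⟩

/-- The inverse is `F` twisted on the right. Over `B` the two twists cancel; over `A` they leave `B`
twisted on both sides, which Φ⁻¹ identifies with `B`. -/
theorem Bimod.IsInvertible.twist {E : Bimod S B A} (h : E.IsInvertible) (Φ : B ≃ₐ[S] B) :
    (E.twist Φ).IsInvertible := by
  obtain ⟨F, ⟨φ, h1, h2⟩, ⟨ψ, k1, k2⟩⟩ := h
  obtain ⟨p, hp⟩ := exists_balancedTensor_equiv (F.untwistRight Φ) (E.untwist Φ) Φ Φ.surjective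
    (F.untwistRight_smul Φ) (E.untwist_smul Φ)
  obtain ⟨q, hq⟩ := exists_balancedTensor_equiv (E.untwist Φ) (F.untwistRight Φ) id
    Function.surjective_id (fun _ _ => rfl) (fun _ _ => rfl)
  let Φ' : Bimod.regular S B ≃ₗ[S] Bimod.regular S B := Φ.symm.toLinearEquiv
  have hl : ∀ (b : B) (t : Bimod.regular S B), Φ' (Φ b • t) = b • Φ' t := fun b (t : B) =>
    (map_mul Φ.symm (Φ b) t).trans (by rw [Φ.symm_apply_apply]; rfl)
  have hr : ∀ (b : B) (t : Bimod.regular S B), Φ' (t <• Φ b) = Φ' t <• b := fun b (t : B) =>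
    (map_mul Φ.symm t (Φ b)).trans (by rw [Φ.symm_apply_apply]; rfl)
  refine ⟨F.twistRight Φ, ⟨p.trans φ, fun a y x => ?_, fun y x a => ?_⟩,
    ⟨(q.trans ψ).trans Φ', fun b y x => ?_, fun y x b => ?_⟩⟩
  · rw [LinearEquiv.trans_apply, LinearEquiv.trans_apply, hp, hp]
    exact h1 a _ _
  · rw [LinearEquiv.trans_apply, LinearEquiv.trans_apply, hp, hp]
    exact h2 _ _ a
  · simp only [LinearEquiv.trans_apply, hq, E.untwist_smul, k1, hl]
  · simp only [LinearEquiv.trans_apply, hq, F.untwistRight_smul, k2, hr]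

end Twist

/-! ### Hermitian frames from (III) and (IV). -/

section Hermitian

variable {S : Type w} [CommRing S] {A B : Type u}
  [Ring A] [StarRing A] [Algebra S A] [Ring B] [StarRing B] [Algebra S B]

/-- Given (III) and (IV), an equivalence bimodule has a hermitian frame. -/
theorem Bimod.IsInvertible.exists_isHermitian {E : Bimod S B A} (hE : E.IsInvertible)
    (hI : CondI A) (hIII : CondIII S A B) (hIV : CondIV S B) :
    ∃ (n : ℕ) (F : Frame E n), F.IsHermitian := by
  obtain ⟨⟨n, ⟨F₀⟩⟩, hfull, -⟩ := hE.morita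
  obtain ⟨F, hP⟩ := F₀.exists_isStarProjection hI
  obtain ⟨ψ⟩ := hIII n _ hP ⟨F.cornerEquiv hfull hP, F.cornerEquiv_smul hfull hP⟩
  -- Φ compares the coordinate isomorphism with the `*`-isomorphism ψ, so it carries all the failure
  -- of `mat` to respect the involution.
  let Φ₀ : B ≃+* B := (F.cornerEquiv hfull hP).trans ψ.symm.toRingEquiv
  have hΦ₀ : ∀ b, Φ₀ b = ψ.symm (F.cornerEquiv hfull hP b) := fun b => rfl
  let Φ : B ≃ₐ[S] B := AlgEquiv.ofRingEquiv (f := Φ₀) fun c => by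
    rw [Algebra.algebraMap_eq_smul_one, hΦ₀, F.cornerEquiv_smul, map_smul, ← hΦ₀, map_one]
  obtain ⟨Ψ, hΦ, hψ, hψs⟩ : ∃ Ψ : B → Matrix (Fin n) (Fin n) A, (∀ b, Ψ (Φ b) = F.mat b) ∧
      (∀ b c, Ψ b * Ψ c = Ψ (b * c)) ∧ ∀ b, star (Ψ b) = Ψ (star b) := by
    refine ⟨fun b => (ψ b).1, fun b => ?_, fun b c => ?_, fun b => ?_⟩
    · change (ψ (ψ.symm (F.cornerEquiv hfull hP b))).1 = _
      rw [ψ.apply_symm_apply, F.coe_cornerEquiv]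
    · exact congrArg Subtype.val (map_mul ψ b c).symm
    · exact congrArg Subtype.val (map_star ψ b).symm
  obtain ⟨U, hU⟩ := hIV Φ
  -- The new representation is b ↦ Ψ(U Φ(b) U⁻¹). Since Φ(b)* = U*U Φ(b*) (U*U)⁻¹ by (IV), the
  -- adjoint of UΦ(b)U⁻¹ is UΦ(b*)U⁻¹.
  refine ⟨n, F.change (Ψ U) (Ψ ↑U⁻¹) ?_, fun b => ?_⟩
  · rw [← hΦ, hψ, hψ, U.inv_mul, one_mul]
  · rw [F.change_mat, F.change_mat, ← hΦ, ← hΦ, hψ, hψ, hψ, hψ, hψs]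
    congr 1
    have h := hU (Φ (star b))
    rw [Φ.symm_apply_apply, star_star] at h
    have hs : star (↑U⁻¹ : B) * star (U : B) = 1 := by rw [← star_mul, U.mul_inv, star_one]
    have hs' : (↑(star U)⁻¹ : B) * star (U : B) = 1 := (star U).inv_mul
    rw [star_mul, star_mul, h, mul_inv_rev, Units.val_mul, Units.val_mul, Units.coe_star]
    calc _ = star (↑U⁻¹ : B) * star (U : B) * (U * Φ (star b) * ↑U⁻¹) *
          ((↑(star U)⁻¹ : B) * star (U : B)) := by simp only [mul_assoc]
      _ = _ := by rw [hs, hs', one_mul, mul_one]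

end Hermitian

/-! ### The intertwiner from two strong equivalence bimodules. -/

section Twisting

variable {R : Type w} [CommRing R] [LinearOrder R] [IsStrictOrderedRing R]
  {A B : Type u}
  [Ring A] [StarRing A] [Algebra (Cx R) A]
  [Ring B] [StarRing B] [Algebra (Cx R) B]

/-- A strong equivalence bimodule whose twist by `Φ` also underlies a strong equivalence bimodule
yields the intertwiner between `Φ` and `Φ*`. -/
theorem exists_units_of_iso_twist {E G : PreHilbertBimod R B A} (hE : E.IsInvertible)
    (hG : G.IsInvertible) (hI : CondI A) (hII : CondIIMinus R A) (Φ : B ≃ₐ[Cx R] B)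
    (hiso : Bimod.Iso G.toBimod (E.toBimod.twist Φ)) :
    ∃ U : Bˣ, ∀ b : B,
      star (Φ (star (Φ.symm b))) = ↑(star U * U) * b * ↑(star U * U)⁻¹ := by
  obtain ⟨n, F, hF⟩ := hE.exists_isOrthonormal hI hII
  obtain ⟨-, hfull, -⟩ := hE.toBimod.morita
  obtain ⟨χ, hχ, hχ'⟩ := hiso
  let e₀ : G ≃ₗ[Aᵐᵒᵖ] E :=
    { toFun := χ
      invFun := χ.symm
      left_inv := χ.left_inv
      right_inv := χ.right_inv
      map_add' := χ.map_add
      map_smul' := fun a x => hχ' x a.unop }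
  have he₀ : ∀ (b : B) x, e₀ (b • x) = Φ b • e₀ x := hχ
  let e : E ≃ₗ[Aᵐᵒᵖ] G := e₀.symm
  have he : ∀ (b : B) x, e (Φ b • x) = b • e x := fun b x => by
    apply e₀.injective
    rw [he₀]
    simp [e]
  have hP : IsStarProjection (F.mat 1) := ⟨F.isIdempotentElem_mat_one, hF.star_mat_one⟩
  have hcol : ∀ x, (F.map e).col (e x) = F.col x := fun x => by
    ext i
    exact congrArg (F.coord i) (e.symm_apply_apply x)
  -- The idempotent depends only on the right module, so the frame carried to `G` has the same
  -- projection.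
  have hmat : (F.map e).mat 1 = F.mat 1 := by
    refine Matrix.ext_of_mulVec_single fun j => ?_
    rw [← Frame.col_comb, ← Frame.col_comb, Frame.comb_single, Frame.comb_single]
    exact hcol _
  obtain ⟨V, W, h1, h2, h3, h4, h5, h6, h7⟩ :=
    (F.map e).exists_inner_eq_mulVec hG hII (by rwa [hmat])
  rw [hmat] at h1 h2 h3 h4 h5 h6
  -- The correction V and its inverse W lie in the corner, so they are matrices of mutually inverse
  -- elements of `B`.
  obtain ⟨u, rfl⟩ := F.exists_mat_eq hfull V h1 h2
  obtain ⟨v, rfl⟩ := F.exists_mat_eq hfull W h3 h4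
  rw [← F.mat_mul] at h5 h6
  let U : Bˣ := ⟨u, v, F.mat_injective hfull h5, F.mat_injective hfull h6⟩
  have hG' : ∀ x y, G.inner (e x) (e y) = E.inner x ((star u * u) • y) := fun x y => by
    rw [h7, hcol, hcol, ← F.col_smul, ← F.col_smul, ← hF.inner_eq, E.compatible, mul_smul]
  refine ⟨U, fun b => ?_⟩
  -- Pair with x on the left and pass through the inner product of `G`, where Φ⁻¹(b)* moves across
  -- as Φ⁻¹(b); on `E` these act as Φ(Φ⁻¹(b)*) and b.
  have hint : star (Φ (star (Φ.symm b))) * (star u * u) = star u * u * b := by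
    rw [← sub_eq_zero]
    refine hfull.faithful _ fun y => ?_
    rw [sub_smul, sub_eq_zero]
    refine E.inner_left_ext fun x => ?_
    rw [mul_smul, ← E.compatible, ← hG', he, G.compatible, star_star, ← he, hG',
      Φ.apply_symm_apply, mul_smul (star u * u)]
  exact (Units.eq_mul_inv_iff_mul_eq _).2 hint

end Twisting

end StrongMorita

/-! ### The equivalence of surjectivity and (IV). -/

theorem corollary7p10
    {R : Type w} [CommRing R] [LinearOrder R] [IsStrictOrderedRing R]
    {A B : Type u}
    [Ring A] [StarRing A] [Algebra (StrongMorita.Cx R) A] [StarModule (StrongMorita.Cx R) A]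
    [Ring B] [StarRing B] [Algebra (StrongMorita.Cx R) B] [StarModule (StrongMorita.Cx R) B]
    (hIII : StrongMorita.CondIII (StrongMorita.Cx R) A B)
    (hI : StrongMorita.CondI A)
    (hII : StrongMorita.CondIIMinus R A)
    (hPic : Nonempty (StrongMorita.Pic (StrongMorita.Cx R) B A)) :
    Function.Surjective (StrongMorita.strPicToPic R B A) ↔
      StrongMorita.CondIV (StrongMorita.Cx R) B := by
  constructor
  · intro hs Φ
    obtain ⟨q⟩ := hPic
    obtain ⟨p, -⟩ := hs q
    obtain ⟨⟨E, hE⟩, rfl⟩ := Quotient.exists_rep p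
    -- Surjectivity is used twice: once to have a strong `E` at all, and once to lift its twist.
    obtain ⟨p', hp'⟩ := hs (Quotient.mk _ ⟨E.toBimod.twist Φ, hE.toBimod.twist Φ⟩)
    obtain ⟨⟨G, hG⟩, rfl⟩ := Quotient.exists_rep p'
    exact StrongMorita.exists_units_of_iso_twist hE hG hI hII Φ (Quotient.exact hp')
  · intro hIV q
    obtain ⟨⟨E, hE⟩, rfl⟩ := Quotient.exists_rep q
    obtain ⟨n, F, hF⟩ := hE.exists_isHermitian hI hIII hIV
    -- The inner product is put on the given `E`, so forgetting it returns `E` definitionally.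
    exact ⟨Quotient.mk _ ⟨F.preHilbert hF, hF.isOrthonormal.isInvertible hI hII hE⟩, rfl⟩
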